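/- **Game.** There are $K\ge 1$ arms $1,\dots,K$, $N$ defenders with $1\le N\le K$, one attacker, and a horizon of $T$ rounds. The rewards $X_k(t)\in[0,1]$ are independent, $X_k(t)$ has law $\nu_k$ with mean $\mu_k$, and the means are distinct, $\mu_{(1)}>\dots>\mu_{(K)}$. In each round every defender pulls an arm, and the attacker pulls an arm or stays quiet. A player who pulls an arm $k$ observes the collision indicator $\eta_k(t)$ (whether another player also pulls $k$) and her reward $X_k(t)(1-\eta_k(t))$. The attacker's strategy is randomized and uses only her private randomness and her own past observations. With $\pi^j(t)$ the arm of defender $j$, the regret is $R_T=T\sum_{i=1}^N\mu_{(i)}-\sum_{t=1}^{T}\sum_{j=1}^N\mu_{\pi^j(t)}(1-\eta_{\pi^j(t)}(t))$. The attack cost is the number of rounds in which the attacker pulls the same arm as some defender. **SIC-MMAB** (the algorithm of every defender). 1. *Musical Chairs.* For $\lceil K\log T\rceil$ rounds pull a uniformly random arm until the first round without collision, and from then on stay on the arm of that round, say $k$. 2. *Estimation of the number of players*, $2K$ rounds. Start with $M=j=1$. Pull $k$ for $2k$ rounds, adding $1$ to both $M$ and $j$ at each collision. Then pull $k+1,k+2,\dots$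 (mod $K$) for $2(K-k)$ rounds, adding $1$ to $M$ at each collision. Then $M$ is the estimated number of players and $j$ the internal rank. 3. *Phases $p=p_0,p_0+1,\dots$*, with $p_0\in\{0,1\}$, $M_p$ active players and $K_p$ active arms listed in increasing order (at first $M_{p_0}=M$ and all $K$ arms). *Exploration:* for $K_p2^p$ rounds pull the active arms cyclically, beginning with the one numbered $j+1$, and add each reward to the sum $s[k]$ of the arm pulled. Then round each $s[k]$ to the integer $\lfloor s[k]+V\rfloor$, with independent $V$ of a fixed law on $[0,1)$. *Communication:* for all $(i,l,k)\in[M_p]\times[M_p]\times[K_p]$ with $i\ne l$, in lexicographic order, the player of rank $i$ sends her integer for arm $k$ to the player of rank $l$ in $p+1$ bits, least significant first. For a bit $1$ she pulls the $l$-th active arm, for a bit $0$ the $i$-th. All other players pull the active arm numbered by their rank, and the receiver reads $1$ if she collides and $0$ otherwise. *Update:* let $s=\sum_{q=p_0}^{p}M_q2^q$ and $b=3\sqrt{\log T/(2s)}$, and let $\tilde\mu_k$ be the sum over all ranks of the last known integers for arm $k$, divided by $s$. Arm $i$ beats arm $k$ if $\tilde\mu_i-b\ge\tilde\mu_k+b$.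 The list Acc, in increasing order, consists of the active arms that beat at least $K_p-M_p$ active arms; Rej consists of those beaten by at least $M_p$ active arms. If $|\mathrm{Acc}|\ge M_p-j+1$, the player pulls the arm numbered $M_p-j+1$ in Acc until the end. Otherwise $M_{p+1}=M_p-|\mathrm{Acc}|$ and the arms of Acc and Rej become inactive. If Musical Chairs finds no arm, or if $M>K$, the algorithm is not defined; the defender then pulls an arbitrary prescribed sequence of arms. **Proposition.** There are universal constants $C,c>0$ and, for each $K\ge1$, a number $T_0(K)$ with the following property. For all $K\ge 1$, $p_0\in\{0,1\}$ and $T$ there is a strategy of a single attacker, depending only on $K,p_0,T$, whose private randomness includes a target arm $\hat k$ that is uniform on the $K$ arms, such that for all $N$ with $1\le N\le K$, all reward laws $\nu_1,\dots,\nu_K$ as above, all laws of the rounding variables $V$ and all prescribed sequences of arms for the undefined cases, if the defenders use SIC-MMAB: - the expected attack cost is at most $C\,K^2\log T$; - if $T\ge T_0(K)$ and $N<K$, then for each arm $k$, with probability at least $c/K$, we have $\hat k=k$ and some defender pulls $\hat k$ in every round after the first $C\,K^2\log T$ rounds; - if $T\ge T_0(K)$ and $N<K$, then $$\mathbb E R_T\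 \ge\ c\,(\mu_{(N)}-\mu_{(N+1)})\,\frac{K-N}{K}\,T .$$ -/

import Mathlib

open MeasureTheory

noncomputable section

namespace SicMmab

/-! ### The defenders' algorithm

Arms are `0, …, K - 1` and internal ranks are `0, 1, …`, so that both are one less than the
numbers `1, 2, …` of the usual pseudocode. A player who pulls an arm observes its collision
indicator and the reward received. -/

/-- What a player sees after a round: the collision indicator and the reward. -/
abbrev Feedback := Bool × ℝ

/-- One round of a communication phase: `(i, l, k, b)` is the round in which the player of rank `i`
sends to the player of rank `l` the bit of weight `2 ^ b` of her statistic of arm `k`. -/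
abbrev Slot (K : ℕ) := Fin K × Fin K × Fin K × ℕ

/-- What a player remembers between exploration and communication, apart from her reward sums. -/
structure Memory (K : ℕ) where
  /-- own internal rank -/
  rank : Fin K
  /-- current phase number `p` -/
  phase : ℕ
  /-- number `M_p` of active players -/
  players : ℕ
  /-- the active arms `[K_p]`, in increasing order -/
  arms : List (Fin K)
  /-- number of pulls, by all players together, of each currently active arm -/
  pulls : ℕ
  /-- `stat l k` is the last integer statistic of arm `k` known to come from the player of
  rank `l`; for the own rank it is the own rounded reward sum -/
  stat : Fin K → Fin K → ℕ

/-- The stages of the algorithm. `n` counts the rounds already spent in the stage. -/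
inductive Stage (K : ℕ) where
  /-- Musical Chairs; `fixed` is the arm the player sits on, if she has found one -/
  | chairs (fixed : Option (Fin K)) (n : ℕ)
  /-- estimation of the number of players; `k` is the arm found by Musical Chairs, `M` and `r` are
  the current values of the number of players and of the rank -/
  | estimate (k : Fin K) (M r n : ℕ)
  | explore (m : Memory K) (n : ℕ)
  /-- communication; `todo` lists the remaining rounds of the phase -/
  | comm (m : Memory K) (todo : List (Slot K))
  | exploit (k : Fin K)
  /-- the pseudocode gives no instruction: Musical Chairs has not found an arm, or the estimated
  number of players exceeds the number of arms -/
  | undef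

/-- A player's state: her stage, and the sum of the rewards she collected on each arm in the
exploration phases. -/
abbrev State (K : ℕ) := Stage K × (Fin K → ℝ)

/-- Length `⌈K log T⌉` of Musical Chairs. -/
def chairsLength (K T : ℕ) : ℕ := ⌈(K : ℝ) * Real.log T⌉₊

/-- The rounds of a communication phase, in order: all `(i, l, k)` with `i ≠ l` active players and
`k` an active arm, lexicographically, and `p + 1` bits for each, least significant first. -/
def schedule {K : ℕ} (m : Memory K) : List (Slot K) :=
  let ranks := (List.finRange K).filter fun i => i.val < m.players
  ranks.flatMap fun i => (ranks.filter fun l => l ≠ i).flatMap fun l =>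
    m.arms.flatMap fun k => (List.range (m.phase + 1)).map fun b => (i, l, k, b)

/-- Centralized empirical mean of an active arm (ranks that do not exist contribute `0`). -/
def empMean {K : ℕ} (m : Memory K) (k : Fin K) : ℝ :=
  (∑ l : Fin K, (m.stat l k : ℝ)) / m.pulls

/-- Confidence width `3 √(log T / (2 s))` after `s` pulls. -/
def width (T s : ℕ) : ℝ := 3 * Real.sqrt (Real.log T / (2 * s))

/-- Arm `i` is found to be better than arm `k`. -/
def Beats {K : ℕ} (T : ℕ) (m : Memory K) (i k : Fin K) : Prop :=
  empMean m k + width T m.pulls ≤ empMean m i - width T m.pulls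

open scoped Classical in
/-- Accepted arms, in increasing order: those better than at least `K_p - M_p` active arms. -/
def accepted {K : ℕ} (T : ℕ) (m : Memory K) : List (Fin K) :=
  m.arms.filter fun k =>
    m.arms.length ≤ (m.arms.filter fun i => Beats T m k i).length + m.players

open scoped Classical in
/-- Rejected arms: those worse than at least `M_p` active arms. -/
def rejected {K : ℕ} (T : ℕ) (m : Memory K) : List (Fin K) :=
  m.arms.filter fun k => m.players ≤ (m.arms.filter fun i => Beats T m i k).length

/-- End of a communication phase. The player of (one-based) rank `j` takes the accepted arm number
`M_p - j + 1` if there is one, and otherwise starts the next phase. -/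
def endPhase {K : ℕ} (T : ℕ) (m₀ : Memory K) : Stage K :=
  let m := { m₀ with pulls := m₀.pulls + m₀.players * 2 ^ m₀.phase }
  let acc := accepted T m
  let rej := rejected T m
  match acc[m.players - 1 - m.rank.val]? with
  | some k => .exploit k
  | none => .explore
      { m with
        phase := m.phase + 1
        players := m.players - acc.length
        arms := m.arms.filter fun k => k ∉ acc ∧ k ∉ rej } 0

/-- The rest `todo` of a communication phase; if nothing is left, the phase ends. -/
def continueComm {K : ℕ} (T : ℕ) (m : Memory K) (todo : List (Slot K)) : Stage K :=
  match todo with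
  | [] => endPhase T m
  | slot :: rest => .comm m (slot :: rest)

/-- The active arm at a position of the list of active arms. The default is never used, because
there are always at least as many active arms as active players. -/
def nthArm {K : ℕ} (m : Memory K) (n : ℕ) : Fin K := m.arms.getD n m.rank

/-- The arm pulled in round `t` by a player in stage `st`. The arm `u` is drawn uniformly in every
round, but it is used only in Musical Chairs; `fallback` is used only where the pseudocode gives no
instruction. -/
def pull {K : ℕ} (fallback : ℕ → Fin K) (st : Stage K) (t : ℕ) (u : Fin K) : Fin K :=
  match st with
  | .chairs fixed _ => fixed.getD u
  | .estimate k _ _ n =>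
      -- `2 (k + 1)` rounds on arm `k`, then hopping to `k + 1, k + 2, …` modulo `K`
      if n < 2 * (k.val + 1) then k
      else ⟨(n - k.val - 1) % K, Nat.mod_lt _ k.pos⟩
  | .explore m n => nthArm m ((m.rank.val + n + 1) % m.arms.length)
  | .comm m todo =>
      match todo with
      | (i, l, k, b) :: _ =>
          if m.rank = i ∧ (m.stat i k).testBit b then nthArm m l else nthArm m m.rank
      | [] => nthArm m m.rank
  | .exploit k => k
  | .undef => fallback t

/-- The state after a round in which the player has pulled `a` and observed `fb`. At the end of an
exploration phase the reward sum `s k` is rounded to the integer `⌊s k + v k⌋`, with `v k ∈ [0,1)`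
the player's private random numbers; `p₀` is the number of the first phase. -/
def next {K : ℕ} (T p₀ : ℕ) (s : State K) (v : Fin K → ℝ) (a : Fin K) (fb : Feedback) : State K :=
  match s.1 with
  | .chairs fixed n =>
      let fixed' := if fixed = none ∧ fb.1 = false then some a else fixed
      if n + 1 < chairsLength K T then (.chairs fixed' (n + 1), s.2)
      else match fixed' with
        | some k => (.estimate k 1 0 0, s.2)
        | none => (.undef, s.2)
  | .estimate k M r n =>
      let M' := if fb.1 then M + 1 else M
      let r' := if fb.1 ∧ n < 2 * (k.val + 1) then r + 1 else r
      if n + 1 < 2 * K then (.estimate k M' r' (n + 1), s.2)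
      else if h : r' < K ∧ M' ≤ K then
        (.explore ⟨⟨r', h.1⟩, p₀, M', List.finRange K, 0, fun _ _ => 0⟩ 0, s.2)
      else (.undef, s.2)
  | .explore m n =>
      let sums := Function.update s.2 a (s.2 a + fb.2)
      if n + 1 < m.arms.length * 2 ^ m.phase then (.explore m (n + 1), sums)
      else
        let m' := { m with
          stat := Function.update m.stat m.rank fun k => ⌊sums k + v k⌋₊ }
        (continueComm T m' (schedule m'), sums)
  | .comm m todo =>
      match todo with
      | (i, l, k, b) :: rest =>
          let old := if b = 0 then 0 else m.stat i k
          let m' := if m.rank = l then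
              { m with
                stat := Function.update m.stat i
                  (Function.update (m.stat i) k (old + (if fb.1 then 2 ^ b else 0))) }
            else m
          (continueComm T m' rest, s.2)
      | [] => (endPhase T m, s.2)
  | .exploit k => (.exploit k, s.2)
  | .undef => (.undef, s.2)

/-! ### The attacker -/

/-- A randomized strategy of a single attacker. She first draws a target arm together with some
further private randomness. Her move in round `t` (an arm, or `none` for staying quiet) is a
function of this draw and of her own past feedback: `h n` is her feedback of round `n` if `n < t`
and she pulled an arm in round `n`, and `(false, 0)` otherwise. -/
structure Attack (K : ℕ) where
  law : PMF (Fin K × ℕ)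
  act : Fin K × ℕ → ℕ → (ℕ → Feedback) → Option (Fin K)
  measurable_act : ∀ s t a, MeasurableSet {h | act s t h = a}

/-! ### The game -/

/-- Randomness of one round: the rewards of the arms, and each defender's private randomness. -/
abbrev Round (K N : ℕ) := (Fin K → ℝ) × (Fin N → Fin K × (Fin K → ℝ))

/-- All the randomness of the game: the attacker's draw and the `T` rounds. -/
abbrev Outcome (K N T : ℕ) := (Fin K × ℕ) × (Fin T → Round K N)

/-- Law of one round: independent rewards with laws `ν k`; for each defender an independent uniform
arm and independent rounding variables with law `ρ`. -/
def roundLaw {K : ℕ} [NeZero K] (N : ℕ) (ν : Fin K → Measure ℝ) (ρ : Measure ℝ) :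
    Measure (Round K N) :=
  (Measure.pi ν).prod
    (Measure.pi fun _ : Fin N =>
      (PMF.uniformOfFintype (Fin K)).toMeasure.prod (Measure.pi fun _ : Fin K => ρ))

/-- Law of the game: the rounds are i.i.d. and independent of the attacker's draw. -/
def gameLaw {K : ℕ} [NeZero K] (N T : ℕ) (A : Attack K) (ν : Fin K → Measure ℝ) (ρ : Measure ℝ) :
    Measure (Outcome K N T) :=
  A.law.toMeasure.prod (Measure.pi fun _ : Fin T => roundLaw N ν ρ)

/-- Defender `j` collides, when the defenders pull `d` and the attacker moves `a`. -/
def defCollides {K N : ℕ} (d : Fin N → Fin K) (a : Option (Fin K)) (j : Fin N) : Bool :=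
  decide ((∃ i, i ≠ j ∧ d i = d j) ∨ a = some (d j))

/-- The attacker collides with some defender. -/
def attCollides {K N : ℕ} (d : Fin N → Fin K) (a : Option (Fin K)) : Bool :=
  decide (∃ j, a = some (d j))

/-- States of all defenders, and the attacker's feedback so far. -/
structure Config (K N : ℕ) where
  state : Fin N → State K
  hist : ℕ → Feedback

/-- The reward received on an arm with realized reward `x`. -/
def received (x : ℝ) (collision : Bool) : ℝ := if collision then 0 else x

variable {K N T : ℕ}

/-- The arms pulled by the defenders in round `t`. -/
def defMoves (fallback : Fin N → ℕ → Fin K) (c : Config K N) (t : ℕ) (w : Round K N) :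
    Fin N → Fin K :=
  fun j => pull (fallback j) (c.state j).1 t (w.2 j).1

/-- One round of the game. -/
def playRound (T p₀ : ℕ) (A : Attack K) (fallback : Fin N → ℕ → Fin K) (s : Fin K × ℕ)
    (c : Config K N) (t : ℕ) (w : Round K N) : Config K N :=
  let d := defMoves fallback c t w
  let a := A.act s t c.hist
  { state := fun j =>
      next T p₀ (c.state j) (w.2 j).2 (d j)
        (defCollides d a j, received (w.1 (d j)) (defCollides d a j))
    hist := match a with
      | none => c.hist
      | some k => Function.update c.hist t
          (attCollides d a, received (w.1 k) (attCollides d a)) }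

/-- The configuration before round `t` (rounds are numbered `0, …, T - 1`). -/
def config (p₀ : ℕ) (A : Attack K) (fallback : Fin N → ℕ → Fin K) (ω : Outcome K N T) :
    ℕ → Config K N
  | 0 => ⟨fun _ => (.chairs none 0, fun _ => 0), fun _ => (false, 0)⟩
  | t + 1 =>
      if h : t < T then
        playRound T p₀ A fallback ω.1 (config p₀ A fallback ω t) t (ω.2 ⟨t, h⟩)
      else config p₀ A fallback ω t

/-- The arm `π^j(t)` pulled by defender `j` in round `t`. -/
def defArm (p₀ : ℕ) (A : Attack K) (fallback : Fin N → ℕ → Fin K) (ω : Outcome K N T)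
    (t : Fin T) (j : Fin N) : Fin K :=
  defMoves fallback (config p₀ A fallback ω t) t (ω.2 t) j

/-- The attacker's move in round `t`. -/
def attArm (p₀ : ℕ) (A : Attack K) (fallback : Fin N → ℕ → Fin K) (ω : Outcome K N T)
    (t : Fin T) : Option (Fin K) :=
  A.act ω.1 t (config p₀ A fallback ω t).hist

/-- The attack cost: the number of rounds in which the attacker collides with a defender. -/
def attackCost (p₀ : ℕ) (A : Attack K) (fallback : Fin N → ℕ → Fin K) (ω : Outcome K N T) : ℝ :=
  ∑ t : Fin T,
    if attCollides (defArm p₀ A fallback ω t) (attArm p₀ A fallback ω t) then 1 else 0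

/-- Mean reward of an arm. -/
def armMean (ν : Fin K → Measure ℝ) (k : Fin K) : ℝ := ∫ x, x ∂(ν k)

/-- The regret of the defenders; `σ` lists the arms in order of decreasing mean. -/
def regret (p₀ : ℕ) (A : Attack K) (fallback : Fin N → ℕ → Fin K) (ν : Fin K → Measure ℝ)
    (σ : Equiv.Perm (Fin K)) (hN : N ≤ K) (ω : Outcome K N T) : ℝ :=
  T * ∑ i : Fin N, armMean ν (σ (Fin.castLE hN i)) -
    ∑ t : Fin T, ∑ j : Fin N,
      received (armMean ν (defArm p₀ A fallback ω t j))
        (defCollides (defArm p₀ A fallback ω t) (attArm p₀ A fallback ω t) j)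

/-- From round `τ` on, some defender always pulls the target arm drawn by the attacker. -/
def CommitsToTarget (p₀ : ℕ) (A : Attack K) (fallback : Fin N → ℕ → Fin K) (τ : ℝ)
    (ω : Outcome K N T) : Prop :=
  ∃ j : Fin N, ∀ t : Fin T, τ ≤ (t : ℕ) → defArm p₀ A fallback ω t j = ω.1.1

end SicMmab

end

/-! The attack makes one defender believe that there are `K` players. The algorithm accepts an
active arm that beats at least `K_p - M_p` active arms, so with `M_p = K_p = K` all the arms are
accepted at the end of the first phase, whatever the rewards and the communicated integers are. A
player of rank `K - 1 - g` (ranks and arms counted from `0`) then takes arm `g` for ever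
(`OnTrack`, `Locked.endPhase`).

The number of players and the rank are counts of collisions in the `2 K` rounds of the estimation
stage, where the moves of the defenders are determined by the arms on which they sit. The attacker
finds these arms by a sweep through all arms in the last `K` rounds of Musical Chairs
(`config_sweep`), and then hits one of the defenders, the victim, in chosen rounds
(`config_estimate`). The victim on arm `v` needs `K - 1` collisions, among them `K - 1 - g` in the
first `2 (v + 1)` rounds, and her collisions with the other defenders are included. Suitable rounds
exist if `v` is neither too small nor too large and the numbers of defenders below and above `v` are
at most `K - 1 - g` and `g` (`exists_isPlan_of_card_le`). The defender closest to arm `K - 1 - g`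
on a given side satisfies the latter condition (`exists_isPlan`), so it is enough that some
defender sits on one of the arms in `goodArms g`, and these are at least half of all arms. The
attacker makes at most `3 K` moves.

For `N < K`, the first draw of a fixed defender is a good arm which nobody else draws, with
probability at least `1 / 2 * 1 / 3` (`sixth_le_roundLaw_real`). Moreover, all defenders find an
arm before the sweep if each of the `K` joint draws `shiftedDraw` occurs (`isSome_chairsRun`). Each
of them has probability `K ^ (-N)` in each round, so for a horizon that is long in terms of `K`
this happens with probability at least `1 - 1 / 12`. A given target is thus taken with probability at least
`1 / (12 K)`.

The regret of a round is never negative, and at least `μ_(N) - μ_(N+1)` if a defender is on an arm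
that is not among the `N` best (`sum_received_le_sub`). Summing over the `K - N` bad targets gives
the lower bound for the expected regret. -/

noncomputable section

namespace SicMmab

/-! ### Choosing the collisions of one defender -/

/-- Position, in round `n` of the estimation stage, of a defender who has settled on arm `v`. -/
def hop {K : ℕ} (v : Fin K) (n : ℕ) : Fin K :=
  if n < 2 * (v.val + 1) then v else ⟨(n - v.val - 1) % K, Nat.mod_lt _ v.pos⟩

/-- In the estimation stage, two defenders on distinct arms meet exactly once. -/
theorem hop_eq_hop_iff {K : ℕ} {v w : Fin K} (hvw : w ≠ v) {n : ℕ} (hn : n < 2 * K) :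
    hop w n = hop v n ↔ n = v.val + w.val + 1 := by
  have hne : w.val ≠ v.val := fun h => hvw (Fin.ext h)
  have hv := v.isLt
  have hw := w.isLt
  have hmod : ∀ m, m < 2 * K → m % K = if m < K then m else m - K := by
    intro m hm
    split_ifs with h
    · exact Nat.mod_eq_of_lt h
    · rw [Nat.mod_eq_sub_mod (by omega), Nat.mod_eq_of_lt (by omega)]
  have h1 := hmod (n - v.val - 1) (by omega)
  have h2 := hmod (n - w.val - 1) (by omega)
  unfold hop
  rw [Fin.ext_iff]
  split_ifs with ha hb hb
  · omega
  · simp only [h1]; split_ifs <;> omega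
  · simp only [h2]; split_ifs <;> omega
  · simp only [h1, h2]; split_ifs <;> omega

/-- The attacker's plan for the estimation stage, when `S` is the set of arms on which the defenders
sit: `v` is the arm of the victim, and `H` the set of the rounds in which the victim is to
collide. The set `H` contains the collisions of the victim with the other defenders. Its
cardinalities are such that the victim counts `K` players and ends with the rank that takes
arm `g` as soon as all arms are accepted. -/
structure IsPlan {K : ℕ} (S : Finset (Fin K)) (g v : Fin K) (H : Finset ℕ) : Prop where
  mem : v ∈ S
  subset : H ⊆ Finset.range (2 * K)
  natural : ∀ w ∈ S, w ≠ v → v.val + w.val + 1 ∈ H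
  card : H.card + 1 = K
  card_early : (H.filter fun n => n < 2 * (v.val + 1)).card = K - 1 - g.val

/-- A plan for the victim on arm `v` exists if the collisions that cannot be avoided are not too
many, and the rounds before and after she starts to hop are enough. -/
theorem exists_isPlan_of_card_le {K : ℕ} {S : Finset (Fin K)} {g v : Fin K} (hv : v ∈ S)
    (h₁ : (S.filter fun w => w < v).card ≤ K - 1 - g.val) (h₂ : K - 1 - g.val ≤ 2 * (v.val + 1))
    (h₃ : (S.filter fun w => v < w).card ≤ g.val) (h₄ : g.val ≤ 2 * (K - 1 - v.val)) :
    ∃ H, IsPlan S g v H := by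
  have hv' := v.isLt
  have hg := g.isLt
  have card_image : ∀ A : Finset (Fin K),
      (A.image fun w : Fin K => v.val + w.val + 1).card = A.card := fun A =>
    Finset.card_image_of_injective _ fun a b h => Fin.ext (by simpa using h)
  obtain ⟨H₁, hH₁, hH₁', hc₁⟩ := Finset.exists_subsuperset_card_eq
    (s := (S.filter fun w => w < v).image fun w : Fin K => v.val + w.val + 1)
    (t := Finset.range (2 * (v.val + 1))) (n := K - 1 - g.val)
    (by
      intro n hn
      simp only [Finset.mem_image, Finset.mem_filter, Fin.lt_def] at hn
      obtain ⟨w, ⟨_, hw⟩, rfl⟩ := hn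
      simp only [Finset.mem_range]
      omega)
    (by rw [card_image]; exact h₁) (by simpa using h₂)
  obtain ⟨H₂, hH₂, hH₂', hc₂⟩ := Finset.exists_subsuperset_card_eq
    (s := (S.filter fun w => v < w).image fun w : Fin K => v.val + w.val + 1)
    (t := Finset.Ico (2 * (v.val + 1)) (2 * K)) (n := g.val)
    (by
      intro n hn
      simp only [Finset.mem_image, Finset.mem_filter, Fin.lt_def] at hn
      obtain ⟨w, ⟨_, hw⟩, rfl⟩ := hn
      have := w.isLt
      simp only [Finset.mem_Ico]
      omega)
    (by rw [card_image]; exact h₃) (by rw [Nat.card_Ico]; omega)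
  have early : ∀ n ∈ H₁, n < 2 * (v.val + 1) := fun n hn => by simpa using hH₁' hn
  have late : ∀ n ∈ H₂, 2 * (v.val + 1) ≤ n ∧ n < 2 * K := fun n hn => by simpa using hH₂' hn
  refine ⟨H₁ ∪ H₂, hv, ?_, ?_, ?_, ?_⟩
  · intro n hn
    rcases Finset.mem_union.1 hn with h | h
    · have := early n h
      simp only [Finset.mem_range]
      omega
    · simpa using (late n h).2
  · intro w hw hne
    rcases lt_or_gt_of_ne hne with h | h
    · exact Finset.mem_union_left _ (hH₁ (Finset.mem_image_of_mem _ (by simp [hw, h])))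
    · exact Finset.mem_union_right _ (hH₂ (Finset.mem_image_of_mem _ (by simp [hw, h])))
  · rw [Finset.card_union_of_disjoint, hc₁, hc₂]
    · omega
    · refine Finset.disjoint_left.2 fun n h h' => ?_
      have := early n h
      have := late n h'
      omega
  · rw [Finset.filter_union, Finset.filter_true_of_mem early, Finset.filter_false_of_mem,
      Finset.union_empty, hc₁]
    intro n hn
    have := late n hn
    omega

/-- The arms from which, for the target `g`, a defender alone can be led to the target. One
occupied arm of this kind is enough for a plan. -/
def goodArms {K : ℕ} (g : Fin K) : Finset (Fin K) :=
  Finset.univ.filter fun k => K - 1 - g.val ≤ 2 * (k.val + 1) ∧ g.val ≤ 2 * (K - 1 - k.val)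

/-- The victim is the defender closest to the arm `K - 1 - g`, on the side of the given good arm:
on that side, there is no other defender between her and `K - 1 - g`, which bounds the numbers of
defenders below and above her. -/
theorem exists_isPlan {K : ℕ} {S : Finset (Fin K)} {g k : Fin K} (hk : k ∈ S)
    (hg : k ∈ goodArms g) : ∃ v H, IsPlan S g v H := by
  have hgK := g.isLt
  have hkK := k.isLt
  simp only [goodArms, Finset.mem_filter, Finset.mem_univ, true_and] at hg
  obtain ⟨r, hr⟩ : ∃ r : Fin K, r.val = K - 1 - g.val := ⟨⟨K - 1 - g.val, by omega⟩, rfl⟩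
  rcases le_total k r with hkr | hkr
  · obtain ⟨v, hv, hmax⟩ := (S.filter fun w => w ≤ r).exists_max_image id
      ⟨k, by simp [hk, hkr]⟩
    simp only [Finset.mem_filter, id] at hv hmax
    have hkv : k ≤ v := hmax k ⟨hk, hkr⟩
    have hvr := hv.2
    rw [Fin.le_def] at hkv hvr
    refine ⟨v, exists_isPlan_of_card_le hv.1 ?_ (by omega) ?_ (by omega)⟩
    · calc _ ≤ (Finset.Iio v).card :=
            Finset.card_le_card fun w hw => by simpa using (Finset.mem_filter.1 hw).2
        _ ≤ _ := by rw [Fin.card_Iio]; omega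
    · calc _ ≤ (Finset.Ioi r).card := Finset.card_le_card fun w hw => by
            obtain ⟨hw, hvw⟩ := Finset.mem_filter.1 hw
            rw [Finset.mem_Ioi]
            by_contra h
            exact absurd (hmax w ⟨hw, not_lt.1 h⟩) (not_le.2 hvw)
        _ ≤ _ := by rw [Fin.card_Ioi]; omega
  · obtain ⟨v, hv, hmin⟩ := (S.filter fun w => r ≤ w).exists_min_image id
      ⟨k, by simp [hk, hkr]⟩
    simp only [Finset.mem_filter, id] at hv hmin
    have hkv : v ≤ k := hmin k ⟨hk, hkr⟩
    have hvr := hv.2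
    rw [Fin.le_def] at hkv hvr
    refine ⟨v, exists_isPlan_of_card_le hv.1 ?_ (by omega) ?_ (by omega)⟩
    · calc _ ≤ (Finset.Iio r).card := Finset.card_le_card fun w hw => by
            obtain ⟨hw, hvw⟩ := Finset.mem_filter.1 hw
            rw [Finset.mem_Iio]
            by_contra h
            exact absurd (hmin w ⟨hw, not_lt.1 h⟩) (not_le.2 hvw)
        _ ≤ _ := by rw [Fin.card_Iio]; omega
    · calc _ ≤ (Finset.Ioi v).card :=
            Finset.card_le_card fun w hw => by simpa using (Finset.mem_filter.1 hw).2
        _ ≤ _ := by rw [Fin.card_Ioi]; omega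

theorem le_two_mul_card_goodArms {K : ℕ} (g : Fin K) : K ≤ 2 * (goodArms g).card := by
  have hg := g.isLt
  -- the good arms are those of an interval
  have key : (Finset.Icc ((K - 2 - g.val) / 2) ((2 * K - 2 - g.val) / 2)).card
      ≤ (goodArms g).card := by
    refine Finset.card_le_card_of_injOn (fun n => ⟨n % K, Nat.mod_lt _ g.pos⟩) ?_ ?_
    · intro n hn
      simp only [Finset.coe_Icc, Set.mem_Icc] at hn
      have : n % K = n := Nat.mod_eq_of_lt (by omega)
      simp only [goodArms, Finset.coe_filter, Finset.mem_univ, true_and, Set.mem_ofPred_eq, this]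
      omega
    · intro n hn m hm h
      simp only [Finset.coe_Icc, Set.mem_Icc] at hn hm
      rw [Fin.mk.injEq, Nat.mod_eq_of_lt (by omega), Nat.mod_eq_of_lt (by omega)] at h
      exact h
  rw [Nat.card_Icc] at key
  omega

/-! ### Musical Chairs without an attacker -/

/-- One round of Musical Chairs among the defenders, who draw the arms `u`. -/
def chairsStep {K N : ℕ} (u : Fin N → Fin K) (f : Fin N → Option (Fin K)) :
    Fin N → Option (Fin K) := fun j =>
  if f j = none ∧ ¬ ∃ i, i ≠ j ∧ (f i).getD (u i) = (f j).getD (u j) then some (u j) else f j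

/-- The arms on which the defenders sit before round `t` of Musical Chairs, when `u` lists all the
draws. -/
def chairsRun {K N : ℕ} (u : ℕ → Fin N → Fin K) : ℕ → Fin N → Option (Fin K)
  | 0 => fun _ => none
  | t + 1 => chairsStep (u t) (chairsRun u t)

theorem chairsRun_mono {K N : ℕ} {u : ℕ → Fin N → Fin K} {t t' : ℕ} (h : t ≤ t') {j : Fin N}
    {a : Fin K} (ha : chairsRun u t j = some a) : chairsRun u t' j = some a := by
  induction t', h using Nat.le_induction with
  | base => exact ha
  | succ n _ ih => simp [chairsRun, chairsStep, ih]

theorem chairsRun_injective {K N : ℕ} (u : ℕ → Fin N → Fin K) (t : ℕ) {i j : Fin N} {a : Fin K}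
    (hi : chairsRun u t i = some a) (hj : chairsRun u t j = some a) : i = j := by
  induction t generalizing i j with
  | zero => simp [chairsRun] at hi
  | succ t ih =>
    by_contra hij
    simp only [chairsRun, chairsStep] at hi hj
    split_ifs at hi hj with h₁ h₂ h₂
    · simp only [Option.some.injEq] at hi hj
      exact h₁.2 ⟨j, Ne.symm hij, by simp [h₁.1, h₂.1, hi, hj]⟩
    · simp only [Option.some.injEq] at hi
      exact h₁.2 ⟨j, Ne.symm hij, by simp [h₁.1, hj, hi]⟩
    · simp only [Option.some.injEq] at hj
      exact h₂.2 ⟨i, hij, by simp [h₂.1, hj, hi]⟩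
    · exact hij (ih hi hj)

theorem chairsRun_of_unique_draw {K N : ℕ} {u : ℕ → Fin N → Fin K} {j : Fin N}
    (h : ∀ i, i ≠ j → u 0 i ≠ u 0 j) : chairsRun u 1 j = some (u 0 j) := by
  simp only [chairsRun, chairsStep, Option.getD_none, true_and, ite_eq_left_iff, not_not]
  rintro ⟨i, hi, he⟩
  exact absurd he (h i hi)

/-- The joint draw in which defender `j` draws arm `j + s` modulo `K`. -/
def shiftedDraw {K N : ℕ} [NeZero K] (hN : N ≤ K) (s : Fin K) : Fin N → Fin K :=
  fun j => Fin.castLE hN j + s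

/-- If all the joint draws `shiftedDraw hN s` occur, in whatever order, then all the defenders have
found an arm: the draws of one of these rounds are distinct, so a defender who never finds an arm
meets a seated defender on each of the `K` arms, which takes more than `N < K` defenders. -/
theorem isSome_chairsRun {K N : ℕ} [NeZero K] (hN : N ≤ K) (hNK : N < K)
    {u : ℕ → Fin N → Fin K} {n : ℕ} (h : ∀ s, ∃ t < n, u t = shiftedDraw hN s) (j : Fin N) :
    ∃ a, chairsRun u n j = some a := by
  by_contra hj
  have hnone : ∀ t ≤ n, chairsRun u t j = none := fun t ht => by
    cases ha : chairsRun u t j with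
    | none => rfl
    | some a => exact absurd ⟨a, chairsRun_mono ht ha⟩ hj
  have hocc : ∀ a : Fin K, ∃ i, chairsRun u n i = some a := by
    intro a
    obtain ⟨t, ht, hu⟩ := h (a - Fin.castLE hN j)
    have ha : u t j = a := by simp [hu, shiftedDraw]
    have h1 := hnone (t + 1) ht
    simp only [chairsRun, chairsStep, hnone t ht.le, true_and] at h1
    split_ifs at h1 with hc
    obtain ⟨i, hij, hi⟩ := hc
    refine ⟨i, chairsRun_mono ht.le ?_⟩
    cases hb : chairsRun u t i with
    | some b => simpa [hb, ha] using hi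
    | none =>
      rw [hb, Option.getD_none, Option.getD_none, hu] at hi
      simp only [shiftedDraw, add_left_inj] at hi
      exact absurd (Fin.castLE_injective hN hi) hij
  choose i hi using hocc
  have inj : Function.Injective i := fun a b hab => by
    have := hi a
    rw [hab, hi b] at this
    exact (Option.some.inj this).symm
  have := Fintype.card_le_of_injective i inj
  simp only [Fintype.card_fin] at this
  omega

section

/-! ### The attack -/

/-- The arms on which the attacker has met a defender in the last `K` rounds of Musical Chairs,
where she visits the arms one after the other. -/
def occupied {K : ℕ} (T : ℕ) (h : ℕ → Feedback) : Finset (Fin K) :=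
  Finset.univ.filter fun a => (h (chairsLength K T - K + a.val)).1 = true

open scoped Classical in
/-- A victim and a set of rounds that form a plan, if there are any. -/
def chosenPlan {K : ℕ} (S : Finset (Fin K)) (g : Fin K) : Option (Fin K × Finset ℕ) :=
  if h : ∃ p : Fin K × Finset ℕ, IsPlan S g p.1 p.2 then some h.choose else none

theorem isPlan_of_mem_chosenPlan {K : ℕ} {S : Finset (Fin K)} {g : Fin K}
    {p : Fin K × Finset ℕ} (hp : p ∈ chosenPlan S g) : IsPlan S g p.1 p.2 := by
  unfold chosenPlan at hp
  split_ifs at hp with h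
  · obtain rfl := Option.some.inj hp
    exact h.choose_spec
  · simp at hp

theorem exists_mem_chosenPlan {K : ℕ} {S : Finset (Fin K)} {g k : Fin K} (hk : k ∈ S)
    (hg : k ∈ goodArms g) : ∃ p, p ∈ chosenPlan S g := by
  obtain ⟨v, H, h⟩ := exists_isPlan hk hg
  have h' : ∃ p : Fin K × Finset ℕ, IsPlan S g p.1 p.2 := ⟨(v, H), h⟩
  exact ⟨h'.choose, by simp [chosenPlan, dif_pos h']⟩

/-- The attacker's move, when her feedback shows the defenders on the arms `S`. She is quiet at
first, visits all arms in the last `K` rounds of Musical Chairs, and then carries out the plan. She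
is always quiet if `T < 2`, because then `log T = 0` and no cost is allowed. -/
def attackMove {K : ℕ} (T : ℕ) (g : Fin K) (t : ℕ) (S : Finset (Fin K)) : Option (Fin K) :=
  if T < 2 ∨ t < chairsLength K T - K then none
  else if h : t < chairsLength K T then
    some ⟨t - (chairsLength K T - K), by have := g.isLt; omega⟩
  else (chosenPlan S g).bind fun p =>
    if t - chairsLength K T ∈ p.2 then some (hop p.1 (t - chairsLength K T)) else none

theorem measurable_occupied {K : ℕ} (T : ℕ) (S : Finset (Fin K)) :
    MeasurableSet {h : ℕ → Feedback | occupied T h = S} := by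
  have : {h : ℕ → Feedback | occupied T h = S} = ⋂ a : Fin K,
      {h : ℕ → Feedback | (h (chairsLength K T - K + a.val)).1 = decide (a ∈ S)} := by
    ext h
    simp only [occupied, Finset.ext_iff, Finset.mem_filter, Finset.mem_univ, true_and,
      Set.mem_ofPred_eq, Set.mem_iInter]
    refine forall_congr' fun a => ?_
    cases (h (chairsLength K T - K + a.val)).1 <;> by_cases ha : a ∈ S <;> simp [ha]
  rw [this]
  refine MeasurableSet.iInter fun a => ?_
  exact ((measurable_pi_apply (chairsLength K T - K + a.val)).fst)
    (MeasurableSet.singleton (decide (a ∈ S)))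

/-- The attacker's strategy for the horizon `T`. Apart from the target, she uses no randomness. -/
def attack (K T : ℕ) [NeZero K] : Attack K where
  law := (PMF.uniformOfFintype (Fin K)).map fun g => (g, 0)
  act s t h := attackMove T s.1 t (occupied T h)
  measurable_act s t a := by
    have : {h : ℕ → Feedback | attackMove T s.1 t (occupied T h) = a} =
        ⋃ S ∈ {S : Finset (Fin K) | attackMove T s.1 t S = a},
          {h : ℕ → Feedback | occupied T h = S} := by
      ext h
      simp
    rw [this]
    exact MeasurableSet.biUnion (Set.to_countable _) fun S _ => measurable_occupied T S

theorem map_fst_law_attack (K T : ℕ) [NeZero K] (k : Fin K) :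
    (attack K T).law.map Prod.fst k = (K : ENNReal)⁻¹ := by
  have : Prod.fst ∘ (fun g : Fin K => (g, (0 : ℕ))) = id := rfl
  simp [attack, PMF.map_comp, this, PMF.map_id]

variable {K N T : ℕ}

theorem pull_estimate (fb : ℕ → Fin K) (k : Fin K) (M r n t : ℕ) (u : Fin K) :
    pull fb (.estimate k M r n) t u = hop k n := rfl

theorem attackMove_of_mem_chosenPlan (hT : 2 ≤ T) {S : Finset (Fin K)} {g : Fin K}
    {p : Fin K × Finset ℕ} (hp : p ∈ chosenPlan S g) (n : ℕ) :
    attackMove T g (chairsLength K T + n) S = if n ∈ p.2 then some (hop p.1 n) else none := by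
  rw [attackMove, if_neg (by omega), dif_neg (by omega), Option.mem_def.1 hp]
  simp

/-- While the defenders hop and the attacker carries out her plan, the victim collides exactly in
the planned rounds. -/
theorem defCollides_victim {x : Fin N → Fin K} (hx : Function.Injective x) {g : Fin K}
    {p : Fin K × Finset ℕ} (hp : IsPlan (Finset.univ.image x) g p.1 p.2) {v : Fin N}
    (hv : x v = p.1) {n : ℕ} (hn : n < 2 * K) :
    defCollides (fun j => hop (x j) n) (if n ∈ p.2 then some (hop p.1 n) else none) v =
      decide (n ∈ p.2) := by
  refine decide_eq_decide.2 ⟨?_, fun h => Or.inr (by simp only [if_pos h, hv])⟩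
  rintro (⟨i, hi, he⟩ | h)
  · have hne : x i ≠ p.1 := hv ▸ hx.ne hi
    dsimp only at he
    rw [hv, hop_eq_hop_iff hne hn] at he
    exact he ▸ hp.natural _ (Finset.mem_image_of_mem _ (Finset.mem_univ i)) hne
  · by_contra hmem
    simp [hmem] at h

theorem card_filter_lt_succ (H : Finset ℕ) (q : ℕ → Prop) [DecidablePred q] (n : ℕ) :
    (H.filter fun m => m < n + 1 ∧ q m).card =
      (H.filter fun m => m < n ∧ q m).card + if n ∈ H ∧ q n then 1 else 0 := by
  split_ifs with h
  · rw [← Finset.card_insert_of_notMem (a := n) (by simp)]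
    congr 1
    ext m
    simp only [Finset.mem_filter, Finset.mem_insert]
    constructor
    · rintro ⟨h1, h2, h3⟩
      rcases (Nat.lt_succ_iff.1 h2).lt_or_eq with h4 | h4
      · exact Or.inr ⟨h1, h4, h3⟩
      · exact Or.inl h4
    · rintro (rfl | ⟨h1, h2, h3⟩)
      · exact ⟨h.1, Nat.lt_succ_self _, h.2⟩
      · exact ⟨h1, h2.trans (Nat.lt_succ_self _), h3⟩
  · rw [add_zero]
    congr 1
    ext m
    simp only [Finset.mem_filter]
    constructor
    · rintro ⟨h1, h2, h3⟩
      rcases (Nat.lt_succ_iff.1 h2).lt_or_eq with h4 | rfl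
      · exact ⟨h1, h4, h3⟩
      · exact absurd ⟨h1, h3⟩ h
    · rintro ⟨h1, h2, h3⟩
      exact ⟨h1, h2.trans (Nat.lt_succ_self _), h3⟩

/-! ### Musical Chairs and the attacker's sweep -/

variable {p₀ : ℕ} {A : Attack K} {fallback : Fin N → ℕ → Fin K} {ω : Outcome K N T}

theorem config_succ {t : ℕ} (ht : t < T) :
    config p₀ A fallback ω (t + 1) =
      playRound T p₀ A fallback ω.1 (config p₀ A fallback ω t) t (ω.2 ⟨t, ht⟩) := by
  simp [config, ht]

variable [NeZero K]

/-- The arms drawn by the defenders in round `t`. -/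
def draws (w : Fin T → Round K N) (t : ℕ) : Fin N → Fin K :=
  fun j => if h : t < T then ((w ⟨t, h⟩).2 j).1 else 0

theorem draws_of_lt {w : Fin T → Round K N} {t : ℕ} (h : t < T) (j : Fin N) :
    draws w t j = ((w ⟨t, h⟩).2 j).1 := dif_pos h

end

section

variable {K N T : ℕ} [NeZero K] {p₀ : ℕ} {fallback : Fin N → ℕ → Fin K} {ω : Outcome K N T}

theorem config_of_le_sweepStart {t : ℕ}
    (ht : t ≤ chairsLength K T - K) (htT : t ≤ T) :
    (∀ j, ((config p₀ (attack K T) fallback ω t).state j).1 =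
        .chairs (chairsRun (draws ω.2) t j) t) ∧
      (config p₀ (attack K T) fallback ω t).hist = fun _ => (false, 0) := by
  have hK : 0 < K := NeZero.pos K
  induction t with
  | zero => exact ⟨fun j => rfl, rfl⟩
  | succ t ih =>
    obtain ⟨ih, ihh⟩ := ih (by omega) (by omega)
    have htT' : t < T := htT
    have hact : ∀ h, (attack K T).act ω.1 t h = none := fun h =>
      if_pos (Or.inr (by omega))
    have hd : ∀ j, defMoves fallback (config p₀ (attack K T) fallback ω t) t (ω.2 ⟨t, htT'⟩) j =
        (chairsRun (draws ω.2) t j).getD (draws ω.2 t j) := fun j => by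
      simp only [defMoves, ih j, pull, draws_of_lt htT']
    rw [config_succ htT']
    refine ⟨fun j => ?_, ?_⟩
    · have hlt : t + 1 < chairsLength K T := by omega
      simp only [playRound, next, ih j, hact, defCollides, hd, if_pos hlt, chairsRun, chairsStep]
      congr 1
      cases h : chairsRun (draws ω.2) t j <;> simp
    · simp only [playRound, hact, ihh]

/-- After the sweep, the defenders are on their arms `x` at the beginning of the estimation stage,
and the attacker knows which arms are occupied. -/
theorem config_sweep {x : Fin N → Fin K} (hT : 2 ≤ T) (hL : K < chairsLength K T)
    (hx : ∀ j, chairsRun (draws ω.2) (chairsLength K T - K) j = some (x j)) {a : ℕ} (ha : a ≤ K)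
    (haT : chairsLength K T - K + a ≤ T) :
    (∀ j, ((config p₀ (attack K T) fallback ω (chairsLength K T - K + a)).state j).1 =
        if a < K then .chairs (some (x j)) (chairsLength K T - K + a)
        else .estimate (x j) 1 0 0) ∧
      ∀ b : Fin K, b.val < a →
        ((config p₀ (attack K T) fallback ω (chairsLength K T - K + a)).hist
          (chairsLength K T - K + b.val)).1 = decide (∃ j, x j = b) := by
  have hK : 0 < K := NeZero.pos K
  induction a with
  | zero =>
    refine ⟨fun j => ?_, fun b hb => absurd hb (Nat.not_lt_zero _)⟩
    rw [if_pos hK, ← hx j]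
    exact (config_of_le_sweepStart le_rfl haT).1 j
  | succ a ih =>
    obtain ⟨ih, ihh⟩ := ih (by omega) (by omega)
    have haK : a < K := ha
    have htT : chairsLength K T - K + a < T := haT
    have hact : ∀ h, (attack K T).act ω.1 (chairsLength K T - K + a) h = some ⟨a, haK⟩ := by
      intro h
      simp only [attack, attackMove]
      rw [if_neg (by omega), dif_pos (by omega)]
      simp
    have hd : ∀ j, defMoves fallback
        (config p₀ (attack K T) fallback ω (chairsLength K T - K + a))
        (chairsLength K T - K + a) (ω.2 ⟨_, htT⟩) j = x j := fun j => by
      simp [defMoves, ih j, pull, haK]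
    rw [← add_assoc, config_succ htT]
    refine ⟨fun j => ?_, fun b hb => ?_⟩
    · simp only [playRound, next, ih j, if_pos haK]
      by_cases h : a + 1 < K
      · rw [if_pos (by omega), if_pos h]
        simp [add_assoc]
      · rw [if_neg (by omega), if_neg h]
        simp
    · simp only [playRound, hact, attCollides, hd]
      rcases (Nat.lt_succ_iff.1 hb).lt_or_eq with h | h
      · rw [Function.update_of_ne (by omega)]
        exact ihh b h
      · rw [h, Function.update_self]
        simp only [Option.some.injEq]
        congr 1
        exact propext (exists_congr fun j => by rw [eq_comm, Fin.ext_iff, Fin.ext_iff, h])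

/-! ### Estimation of the number of players -/

/-- The estimation stage carries out the plan: `p.2` is the set of the rounds in which the victim
collides. -/
theorem config_estimate {x : Fin N → Fin K} (hT : 2 ≤ T) (hL : K < chairsLength K T)
    (hx : ∀ j, chairsRun (draws ω.2) (chairsLength K T - K) j = some (x j))
    {p : Fin K × Finset ℕ} (hp : p ∈ chosenPlan (Finset.univ.image x) ω.1.1)
    {v : Fin N} (hv : x v = p.1) {n : ℕ} (hn : n < 2 * K) (hnT : chairsLength K T + n ≤ T) :
    (∀ j, ∃ M r, ((config p₀ (attack K T) fallback ω (chairsLength K T + n)).state j).1 =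
        .estimate (x j) M r n) ∧
      ((config p₀ (attack K T) fallback ω (chairsLength K T + n)).state v).1 =
        .estimate p.1 (1 + (p.2.filter fun m => m < n ∧ True).card)
          ((p.2.filter fun m => m < n ∧ m < 2 * (p.1.val + 1)).card) n ∧
      occupied T (config p₀ (attack K T) fallback ω (chairsLength K T + n)).hist =
        Finset.univ.image x := by
  have hinj : Function.Injective x := fun i j hij =>
    chairsRun_injective _ _ (hx i) (by rw [hij]; exact hx j)
  induction n with
  | zero =>
    have hLK : chairsLength K T - K + K = chairsLength K T := by omega
    have h := config_sweep (p₀ := p₀) (fallback := fallback) hT hL hx le_rfl (by omega)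
    rw [hLK] at h
    rw [add_zero]
    refine ⟨fun j => ⟨1, 0, ?_⟩, ?_, ?_⟩
    · simp [h.1 j]
    · simp [h.1 v, hv]
    · ext a
      simp [occupied, h.2 a a.isLt]
  | succ n ih =>
    obtain ⟨ih, ihv, ihS⟩ := ih (by omega) (by omega)
    have htT : chairsLength K T + n < T := hnT
    have hact : (attack K T).act ω.1 (chairsLength K T + n)
        (config p₀ (attack K T) fallback ω (chairsLength K T + n)).hist =
          if n ∈ p.2 then some (hop p.1 n) else none := by
      rw [← attackMove_of_mem_chosenPlan hT hp, ← ihS]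
      rfl
    have hd : defMoves fallback (config p₀ (attack K T) fallback ω (chairsLength K T + n))
        (chairsLength K T + n) (ω.2 ⟨_, htT⟩) = fun j => hop (x j) n := by
      funext j
      obtain ⟨M, r, h⟩ := ih j
      simp only [defMoves, h, pull_estimate]
    rw [← add_assoc, config_succ htT]
    simp only [playRound, hact, hd]
    refine ⟨fun j => ?_, ?_, ?_⟩
    · obtain ⟨M, r, h⟩ := ih j
      simp only [h, next, if_pos hn]
      exact ⟨_, _, rfl⟩
    · simp only [ihv, next, if_pos hn, defCollides_victim hinj (isPlan_of_mem_chosenPlan hp) hv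
        (Nat.lt_of_succ_lt hn), card_filter_lt_succ]
      by_cases h : n ∈ p.2 <;> by_cases h' : n < 2 * (p.1.val + 1) <;> simp [h, h', add_assoc]
    · rw [← ihS]
      by_cases h : n ∈ p.2
      · simp only [h, if_true]
        ext a
        have := a.isLt
        simp only [occupied, Finset.mem_filter, Finset.mem_univ, true_and]
        rw [Function.update_of_ne (by omega)]
      · simp only [h, if_false]

end

section

/-! ### The victim takes the target -/

/-- The memory of a victim who is going to take arm `g` at the end of the current phase: with as
many players as active arms, all arms are accepted, and the rank decides. -/
structure Locked {K : ℕ} (g : Fin K) (p₀ : ℕ) (m : Memory K) : Prop where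
  rank : m.rank.val = K - 1 - g.val
  phase : m.phase = p₀
  players : m.players = K
  arms : m.arms = List.finRange K

/-- `OnTrack g p₀ st R`: a player in stage `st` is going to pull arm `g` for ever, after at most
`R` further rounds. A communication phase has at most `K³ (p₀ + 1)` rounds. -/
inductive OnTrack {K : ℕ} (g : Fin K) (p₀ : ℕ) : Stage K → ℕ → Prop
  | explore {m : Memory K} {n R : ℕ} (hm : Locked g p₀ m) (hn : n < K * 2 ^ p₀)
      (hR : K * 2 ^ p₀ + K * K * K * (p₀ + 1) ≤ n + R) : OnTrack g p₀ (.explore m n) R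
  | comm {m : Memory K} {slot : Slot K} {rest : List (Slot K)} {R : ℕ} (hm : Locked g p₀ m)
      (hR : rest.length + 1 ≤ R) : OnTrack g p₀ (.comm m (slot :: rest)) R
  | exploit (R : ℕ) : OnTrack g p₀ (.exploit g) R

variable {K : ℕ} {g : Fin K} {p₀ : ℕ}

theorem Locked.endPhase {m : Memory K} (hm : Locked g p₀ m) (T : ℕ) :
    endPhase T m = .exploit g := by
  have hg := g.isLt
  have hacc : accepted T { m with pulls := m.pulls + m.players * 2 ^ m.phase } =
      List.finRange K := by
    simp [accepted, hm.arms, hm.players]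
  have hget : (List.finRange K)[m.players - 1 - m.rank.val]? = some g := by
    rw [hm.players, hm.rank, show K - 1 - (K - 1 - g.val) = g.val by omega]
    simp
  simp only [SicMmab.endPhase, hacc, hget]

theorem Locked.onTrack_continueComm {m : Memory K} (hm : Locked g p₀ m) (T : ℕ)
    {todo : List (Slot K)} {R : ℕ} (h : todo.length ≤ R) :
    OnTrack g p₀ (continueComm T m todo) R := by
  cases todo with
  | nil => rw [continueComm, hm.endPhase]; exact .exploit R
  | cons s rest => exact .comm hm (by simpa using h)

theorem length_schedule_le (m : Memory K) (hm : m.arms.length ≤ K) :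
    (schedule m).length ≤ K * K * K * (m.phase + 1) := by
  have hflat : ∀ {α β : Type} (l : List α) (f : α → List β) (b : ℕ), l.length ≤ K →
      (∀ a, (f a).length ≤ b) → (l.flatMap f).length ≤ K * b := by
    intro α β l f b hl hf
    rw [List.length_flatMap]
    calc _ ≤ (l.map fun a => (f a).length).length • b :=
          List.sum_le_card_nsmul _ _ fun x hx => by
            obtain ⟨a, _, rfl⟩ := List.mem_map.1 hx
            exact hf a
      _ ≤ K * b := by rw [List.length_map, smul_eq_mul]; exact Nat.mul_le_mul_right _ hl
  have hranks : ((List.finRange K).filter fun i => i.val < m.players).length ≤ K :=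
    (List.length_filter_le _ _).trans_eq (List.length_finRange)
  rw [mul_assoc, mul_assoc]
  exact hflat _ _ _ hranks fun i => hflat _ _ _ ((List.length_filter_le _ _).trans hranks) fun l =>
    hflat _ _ _ hm fun k => by simp

theorem OnTrack.next {T R : ℕ} {s : State K} (h : OnTrack g p₀ s.1 (R + 1)) (p : ℕ)
    (v : Fin K → ℝ) (a : Fin K) (fb : Feedback) : OnTrack g p₀ (next T p s v a fb).1 R := by
  obtain ⟨st, sums⟩ := s
  cases h with
  | @explore m n _ hm hn hR =>
    have hlen : m.arms.length * 2 ^ m.phase = K * 2 ^ p₀ := by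
      rw [hm.arms, hm.phase, List.length_finRange]
    simp only [SicMmab.next]
    split_ifs with h
    · exact .explore hm (hlen ▸ h) (by omega)
    · have hm' : ∀ f, Locked g p₀ { m with stat := f } := fun f =>
        ⟨hm.rank, hm.phase, hm.players, hm.arms⟩
      refine (hm' _).onTrack_continueComm T ?_
      refine (length_schedule_le _ (by simp [hm.arms])).trans ?_
      simp only [hm.phase]
      omega
  | @comm m slot rest _ hm hR =>
    obtain ⟨i, l, k, b⟩ := slot
    simp only [SicMmab.next]
    refine Locked.onTrack_continueComm ?_ T (by omega)
    by_cases h : m.rank = l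
    · rw [if_pos h]
      exact ⟨hm.rank, hm.phase, hm.players, hm.arms⟩
    · rwa [if_neg h]
  | exploit => exact .exploit R

theorem OnTrack.eq_exploit {st : Stage K} (h : OnTrack g p₀ st 0) : st = .exploit g := by
  generalize hR : 0 = R at h
  cases h with
  | explore hm hn hR => have := Nat.zero_le (K * K * K * (p₀ + 1)); omega
  | comm hm hR => omega
  | exploit => rfl

theorem onTrack_config {N T : ℕ} {A : Attack K} {fallback : Fin N → ℕ → Fin K}
    {ω : Outcome K N T} {t R : ℕ} {v : Fin N}
    (h : OnTrack g p₀ ((config p₀ A fallback ω t).state v).1 R) {s : ℕ} (hs : t + s ≤ T) :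
    OnTrack g p₀ ((config p₀ A fallback ω (t + s)).state v).1 (R - s) := by
  induction s with
  | zero => exact h
  | succ s ih =>
    have ih := ih (by omega)
    rw [← add_assoc, config_succ (by omega)]
    refine OnTrack.next ?_ _ _ _ _
    by_cases hR : s < R
    · rwa [show R - (s + 1) + 1 = R - s by omega]
    · rw [show R - s = 0 by omega] at ih
      rw [ih.eq_exploit]
      exact .exploit _

variable [NeZero K] {N T : ℕ} {fallback : Fin N → ℕ → Fin K} {ω : Outcome K N T}

/-- The estimation stage leaves the victim with `K` players and the rank `K - 1 - g`, where `g` is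
the target. -/
theorem onTrack_of_chosenPlan {x : Fin N → Fin K} (hT : 2 ≤ T) (hL : K < chairsLength K T)
    (hx : ∀ j, chairsRun (draws ω.2) (chairsLength K T - K) j = some (x j))
    {p : Fin K × Finset ℕ} (hp : p ∈ chosenPlan (Finset.univ.image x) ω.1.1)
    {v : Fin N} (hv : x v = p.1) (hLT : chairsLength K T + 2 * K ≤ T) :
    OnTrack ω.1.1 p₀
      ((config p₀ (attack K T) fallback ω (chairsLength K T + 2 * K)).state v).1
      (K * 2 ^ p₀ + K * K * K * (p₀ + 1)) := by
  have hK : 0 < K := NeZero.pos K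
  have hplan := isPlan_of_mem_chosenPlan hp
  have hinj : Function.Injective x := fun i j hij =>
    chairsRun_injective _ _ (hx i) (by rw [hij]; exact hx j)
  obtain ⟨n, hn⟩ : ∃ n, 2 * K = n + 1 := ⟨2 * K - 1, by omega⟩
  have htT : chairsLength K T + n < T := by omega
  obtain ⟨hst, hvst, hocc⟩ := config_estimate (p₀ := p₀) (fallback := fallback) hT hL hx hp hv
    (n := n) (by omega) (by omega)
  have hact : (attack K T).act ω.1 (chairsLength K T + n)
      (config p₀ (attack K T) fallback ω (chairsLength K T + n)).hist =
        if n ∈ p.2 then some (hop p.1 n) else none := by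
    rw [← attackMove_of_mem_chosenPlan hT hp, ← hocc]
    rfl
  have hd : defMoves fallback (config p₀ (attack K T) fallback ω (chairsLength K T + n))
      (chairsLength K T + n) (ω.2 ⟨_, htT⟩) = fun j => hop (x j) n := by
    funext j
    obtain ⟨M, r, h⟩ := hst j
    simp only [defMoves, h, pull_estimate]
  have hM : 1 + (p.2.filter fun m => m < n + 1 ∧ True).card = K := by
    rw [Finset.filter_true_of_mem fun m hm => ?_, add_comm, hplan.card]
    have := Finset.mem_range.1 (hplan.subset hm)
    exact ⟨by omega, trivial⟩
  have hr : (p.2.filter fun m => m < n + 1 ∧ m < 2 * (p.1.val + 1)).card = K - 1 - ω.1.1.val := by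
    rw [← hplan.card_early]
    congr 1
    refine Finset.filter_congr fun m hm => and_iff_right ?_
    have := Finset.mem_range.1 (hplan.subset hm)
    omega
  rw [card_filter_lt_succ, ← add_assoc] at hM
  rw [card_filter_lt_succ] at hr
  have hM' : (if decide (n ∈ p.2) = true then 1 + (p.2.filter fun m => m < n ∧ True).card + 1
      else 1 + (p.2.filter fun m => m < n ∧ True).card) = K := by
    refine Eq.trans ?_ hM
    by_cases h : n ∈ p.2 <;> simp [h]
  have hr' : (if decide (n ∈ p.2) = true ∧ n < 2 * (p.1.val + 1) then
      (p.2.filter fun m => m < n ∧ m < 2 * (p.1.val + 1)).card + 1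
      else (p.2.filter fun m => m < n ∧ m < 2 * (p.1.val + 1)).card) = K - 1 - ω.1.1.val := by
    refine Eq.trans ?_ hr
    by_cases h : n ∈ p.2 <;> by_cases h' : n < 2 * (p.1.val + 1) <;> simp [h, h']
  rw [hn, ← add_assoc, config_succ htT]
  simp only [playRound, hact, hd, hvst, next, hn, lt_irrefl, if_false,
    defCollides_victim hinj hplan hv (show n < 2 * K by omega)]
  rw [dif_pos ⟨by rw [hr']; omega, hM'.le⟩]
  exact .explore ⟨hr', rfl, hM', rfl⟩ (by positivity) (by omega)

/-- The victim pulls the target from some round on, if Musical Chairs ends as the attack requires: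
some defender has settled on a good arm in the first round, and all of them before the sweep. -/
theorem exists_defArm_eq_target (hN : N ≤ K) (hNK : N < K) (hT : 2 ≤ T)
    (hL : K < chairsLength K T) {j₀ : Fin N} (hgood : draws ω.2 0 j₀ ∈ goodArms ω.1.1)
    (hfirst : ∀ i, i ≠ j₀ → draws ω.2 0 i ≠ draws ω.2 0 j₀)
    (hall : ∀ s, ∃ t < chairsLength K T - K, draws ω.2 t = shiftedDraw hN s) :
    ∃ v : Fin N, ∀ t : Fin T,
      chairsLength K T + 2 * K + (K * 2 ^ p₀ + K * K * K * (p₀ + 1)) ≤ t.val →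
        defArm p₀ (attack K T) fallback ω t v = ω.1.1 := by
  choose x hx using isSome_chairsRun hN hNK hall
  have hx₀ : x j₀ = draws ω.2 0 j₀ := by
    have h := chairsRun_mono (show 1 ≤ chairsLength K T - K by omega)
      (chairsRun_of_unique_draw hfirst)
    rw [hx] at h
    exact Option.some.inj h
  obtain ⟨p, hp⟩ := exists_mem_chosenPlan (S := Finset.univ.image x)
    (Finset.mem_image_of_mem x (Finset.mem_univ j₀)) (hx₀ ▸ hgood)
  obtain ⟨v, _, hv⟩ := Finset.mem_image.1 (isPlan_of_mem_chosenPlan hp).mem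
  refine ⟨v, fun t ht => ?_⟩
  have htT := t.isLt
  have h := onTrack_config
    (onTrack_of_chosenPlan (p₀ := p₀) (fallback := fallback) hT hL hx hp hv (by omega))
    (s := t.val - (chairsLength K T + 2 * K)) (by omega)
  rw [Nat.add_sub_cancel' (by omega), Nat.sub_eq_zero_of_le (by omega)] at h
  simp only [defArm, defMoves, h.eq_exploit, pull]

/-! ### Cost of the attack -/

/-- The attacker moves in the `K` rounds of her sweep and in the `2 K` rounds of the estimation
stage only. -/
theorem attackCost_le : attackCost p₀ (attack K T) fallback ω ≤ 3 * K := by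
  have h : ∀ t : Fin T, (attArm p₀ (attack K T) fallback ω t).isSome →
      t.val ∈ Finset.Ico (chairsLength K T - K) (chairsLength K T + 2 * K) := by
    intro t ht
    simp only [attArm, attack, attackMove] at ht
    rw [Finset.mem_Ico]
    split_ifs at ht with h₁ h₂
    · simp at ht
    · omega
    · obtain ⟨a, ha⟩ := Option.isSome_iff_exists.1 ht
      obtain ⟨p, hp, hpa⟩ := Option.bind_eq_some_iff.1 ha
      split_ifs at hpa with hmem
      have := Finset.mem_range.1 ((isPlan_of_mem_chosenPlan hp).subset hmem)
      omega
  unfold attackCost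
  rw [Finset.sum_boole]
  have hcard : ((Finset.univ.filter fun t : Fin T =>
      attCollides (defArm p₀ (attack K T) fallback ω t)
        (attArm p₀ (attack K T) fallback ω t) = true).card) ≤ 3 * K := by
    calc _ ≤ (Finset.Ico (chairsLength K T - K) (chairsLength K T + 2 * K)).card := by
          refine Finset.card_le_card_of_injOn Fin.val (fun t ht => h t ?_)
            Fin.val_injective.injOn
          obtain ⟨j, hj⟩ := of_decide_eq_true (Finset.mem_filter.1 (Finset.mem_coe.1 ht)).2
          simp [hj]
      _ ≤ 3 * K := by rw [Nat.card_Ico]; omega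
  exact_mod_cast hcard

theorem attackCost_eq_zero (hT : T < 2) : attackCost p₀ (attack K T) fallback ω = 0 := by
  have h : ∀ t, attArm p₀ (attack K T) fallback ω t = none := fun t => if_pos (Or.inl hT)
  simp [attackCost, attCollides, h]

end

section

/-! ### Measurability of the game -/

instance countable_memory (K : ℕ) : Countable (Memory K) := by
  let f : Memory K → Fin K × ℕ × ℕ × List (Fin K) × ℕ × (Fin K → Fin K → ℕ) := fun m =>
    (m.rank, m.phase, m.players, m.arms, m.pulls, m.stat)
  have hf : Function.Injective f := by
    rintro ⟨⟩ ⟨⟩ h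
    simpa [f] using h
  exact hf.countable

instance countable_stage (K : ℕ) : Countable (Stage K) := by
  let f : Stage K → (Option (Fin K) × ℕ) ⊕ (Fin K × ℕ × ℕ × ℕ) ⊕ (Memory K × ℕ) ⊕
      (Memory K × List (Slot K)) ⊕ Fin K ⊕ Unit := fun st =>
    match st with
    | .chairs fixed n => .inl (fixed, n)
    | .estimate k M r n => .inr (.inl (k, M, r, n))
    | .explore m n => .inr (.inr (.inl (m, n)))
    | .comm m todo => .inr (.inr (.inr (.inl (m, todo))))
    | .exploit k => .inr (.inr (.inr (.inr (.inl k))))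
    | .undef => .inr (.inr (.inr (.inr (.inr ()))))
  have hf : Function.Injective f := by
    intro a b h
    cases a <;> cases b <;> simp_all [f]
  exact hf.countable

instance measurableSpace_stage (K : ℕ) : MeasurableSpace (Stage K) := ⊤

instance discreteMeasurableSpace_stage (K : ℕ) : DiscreteMeasurableSpace (Stage K) :=
  ⟨fun _ => trivial⟩

instance measurableSpace_option_fin (K : ℕ) : MeasurableSpace (Option (Fin K)) := ⊤

instance discreteMeasurableSpace_option_fin (K : ℕ) :
    DiscreteMeasurableSpace (Option (Fin K)) := ⟨fun _ => trivial⟩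

theorem measurable_countable_param {Ω ι β : Type*} [MeasurableSpace Ω] [MeasurableSpace ι]
    [MeasurableSpace β] [Countable ι] [MeasurableSingletonClass ι] {f : Ω → ι} (hf : Measurable f)
    {G : ι → Ω → β} (hG : ∀ i, Measurable (G i)) : Measurable fun ω => G (f ω) ω :=
  (measurable_from_prod_countable_right (f := fun q : ι × Ω => G q.1 q.2) hG).comp
    (hf.prodMk measurable_id)

variable {K N T : ℕ} {p₀ : ℕ} {A : Attack K} {fallback : Fin N → ℕ → Fin K}

theorem measurable_next {Ω : Type*} [MeasurableSpace Ω] {s : Ω → State K} {v : Ω → Fin K → ℝ}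
    {a : Ω → Fin K} {fb : Ω → Feedback} (hs : Measurable s) (hv : Measurable v)
    (ha : Measurable a) (hfb : Measurable fb) :
    Measurable fun ω => next T p₀ (s ω) (v ω) (a ω) (fb ω) := by
  refine measurable_countable_param (f := fun ω => ((s ω).1, a ω, (fb ω).1))
    (hs.fst.prodMk (ha.prodMk hfb.fst))
    (G := fun i ω => next T p₀ (i.1, (s ω).2) (v ω) i.2.1 (i.2.2, (fb ω).2)) ?_
  rintro ⟨st, a, b⟩
  have hconst : (∀ x v' y, next T p₀ (st, x) v' a (b, y) =
      ((next T p₀ (st, fun _ => 0) (fun _ => 0) a (b, 0)).1, x)) →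
      Measurable fun ω => next T p₀ (st, (s ω).2) (v ω) a (b, (fb ω).2) := fun h => by
    rw [funext fun ω => h (s ω).2 (v ω) (fb ω).2]
    exact measurable_const.prodMk hs.snd
  cases st with
  | chairs fixed n =>
    refine hconst fun x v' y => ?_
    simp only [next]
    generalize (if fixed = none ∧ b = false then some a else fixed) = fixed'
    split_ifs
    · rfl
    · cases fixed' <;> rfl
  | estimate k M r n =>
    refine hconst fun x v' y => ?_
    simp only [next]
    split_ifs <;> rfl
  | explore m n =>
    have hsums : Measurable fun ω => Function.update (s ω).2 a ((s ω).2 a + (fb ω).2) :=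
      measurable_pi_iff.2 fun k => by
        have hk : ∀ k, Measurable fun ω => (s ω).2 k := fun k =>
          (measurable_pi_apply k).comp hs.snd
        by_cases h : k = a
        · subst h
          simp only [Function.update_self]
          exact (hk k).add hfb.snd
        · simp only [Function.update_of_ne h]
          exact hk k
    simp only [next]
    split_ifs
    · exact measurable_const.prodMk hsums
    · refine Measurable.prodMk ?_ hsums
      have hfloor : Measurable fun ω => fun k =>
          ⌊Function.update (s ω).2 a ((s ω).2 a + (fb ω).2) k + v ω k⌋₊ :=
        measurable_pi_iff.2 fun k => Nat.measurable_floor.comp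
          (((measurable_pi_apply k).comp hsums).add ((measurable_pi_apply k).comp hv))
      have hdisc : Measurable fun f : Fin K → ℕ =>
          continueComm T { m with stat := Function.update m.stat m.rank f }
            (schedule { m with stat := Function.update m.stat m.rank f }) := Measurable.of_discrete
      exact hdisc.comp hfloor
  | comm m todo =>
    cases todo with
    | nil => exact hconst fun x v' y => rfl
    | cons slot rest => exact hconst fun x v' y => rfl
  | exploit k => exact hconst fun x v' y => rfl
  | undef => exact hconst fun x v' y => rfl

theorem measurable_act {c : Outcome K N T → Config K N} (h : ∀ n, Measurable fun ω => (c ω).hist n)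
    (t : ℕ) : Measurable fun ω => A.act ω.1 t (c ω).hist := by
  refine measurable_countable_param (f := fun ω : Outcome K N T => ω.1) measurable_fst
    (G := fun s ω => A.act s t (c ω).hist) fun s => ?_
  refine measurable_to_countable' fun a => ?_
  exact (measurable_pi_iff.2 h : Measurable fun ω => (c ω).hist) (A.measurable_act s t a)

theorem measurable_defMoves {c : Outcome K N T → Config K N}
    (h : ∀ j, Measurable fun ω => (c ω).state j) (t : Fin T) :
    Measurable fun ω => defMoves fallback (c ω) t (ω.2 t) := by
  refine measurable_pi_iff.2 fun j => ?_
  have hu : Measurable fun ω : Outcome K N T => ((ω.2 t).2 j).1 :=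
    ((measurable_pi_apply j).comp ((measurable_pi_apply t).comp measurable_snd).snd).fst
  have hp : Measurable fun q : Stage K × Fin K => pull (fallback j) q.1 t q.2 :=
    Measurable.of_discrete
  exact hp.comp ((h j).fst.prodMk hu)

theorem measurable_config (t : ℕ) :
    (∀ j, Measurable fun ω : Outcome K N T => (config p₀ A fallback ω t).state j) ∧
      ∀ n, Measurable fun ω : Outcome K N T => (config p₀ A fallback ω t).hist n := by
  induction t with
  | zero => exact ⟨fun j => measurable_const, fun n => measurable_const⟩
  | succ t ih =>
    obtain ⟨ih, ihh⟩ := ih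
    by_cases ht : t < T
    · simp only [config_succ ht, playRound]
      have hd := measurable_defMoves (fallback := fallback) ih ⟨t, ht⟩
      have ha := measurable_act (A := A) ihh t
      have hw : Measurable fun ω : Outcome K N T => ω.2 ⟨t, ht⟩ :=
        (measurable_pi_apply _).comp measurable_snd
      have hx : ∀ k, Measurable fun ω : Outcome K N T => (ω.2 ⟨t, ht⟩).1 k := fun k =>
        (measurable_pi_apply k).comp hw.fst
      have hrec : ∀ k b, Measurable fun ω : Outcome K N T => received ((ω.2 ⟨t, ht⟩).1 k) b := by
        intro k b
        cases b
        · exact hx k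
        · exact measurable_const
      refine ⟨fun j => ?_, fun n => ?_⟩
      · refine measurable_next (ih j) ((measurable_pi_apply j).comp hw.snd).snd
          ((measurable_pi_apply j).comp hd) ?_
        exact measurable_countable_param (hd.prodMk ha)
          (G := fun i ω => (defCollides i.1 i.2 j,
            received ((ω.2 ⟨t, ht⟩).1 (i.1 j)) (defCollides i.1 i.2 j)))
          fun i => measurable_const.prodMk (hrec _ _)
      · refine measurable_countable_param (hd.prodMk ha)
          (G := fun i ω => (match i.2 with
            | none => (config p₀ A fallback ω t).hist
            | some k => Function.update (config p₀ A fallback ω t).hist t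
                (attCollides i.1 i.2, received ((ω.2 ⟨t, ht⟩).1 k) (attCollides i.1 i.2))) n) ?_
        rintro ⟨d, a⟩
        cases a with
        | none => exact ihh n
        | some k =>
          by_cases hn : n = t
          · subst hn
            simpa using measurable_const.prodMk (hrec k _)
          · simpa [Function.update_of_ne hn] using ihh n
    · simpa only [config, dif_neg ht] using And.intro ih ihh

theorem measurable_moves (t : Fin T) :
    Measurable fun ω : Outcome K N T =>
      (defArm p₀ A fallback ω t, attArm p₀ A fallback ω t) :=
  (measurable_defMoves (measurable_config t).1 t).prodMk (measurable_act (measurable_config t).2 t)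

/-- A quantity that is determined by the moves in one round is integrable: it is measurable, and
takes finitely many values. -/
theorem integrable_of_moves (μ : Measure (Outcome K N T)) [IsFiniteMeasure μ] (t : Fin T)
    (F : (Fin N → Fin K) × Option (Fin K) → ℝ) :
    Integrable (fun ω => F (defArm p₀ A fallback ω t, attArm p₀ A fallback ω t)) μ := by
  have hF : Measurable F := Measurable.of_discrete
  refine Integrable.of_bound (hF.comp (measurable_moves t)).aestronglyMeasurable (∑ i, ‖F i‖)
    (Filter.Eventually.of_forall fun ω => ?_)
  exact Finset.single_le_sum (f := fun i => ‖F i‖) (fun i _ => norm_nonneg _) (Finset.mem_univ _)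

theorem integrable_attackCost (μ : Measure (Outcome K N T)) [IsFiniteMeasure μ] :
    Integrable (attackCost p₀ A fallback) μ :=
  integrable_finsetSum _ fun t _ =>
    integrable_of_moves μ t fun q => if attCollides q.1 q.2 then 1 else 0

theorem integrable_regret (μ : Measure (Outcome K N T)) [IsFiniteMeasure μ]
    (ν : Fin K → Measure ℝ) (σ : Equiv.Perm (Fin K)) (hN : N ≤ K) :
    Integrable (regret p₀ A fallback ν σ hN) μ :=
  (integrable_const _).sub <| integrable_finsetSum _ fun t _ =>
    integrable_of_moves μ t fun q => ∑ j, received (armMean ν (q.1 j)) (defCollides q.1 q.2 j)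

end

section

/-! ### Regret per round -/

/-- A set of at most `m` arms collects at most the sum of the `m` largest means. -/
theorem sum_le_sum_top {K : ℕ} {μ : Fin K → ℝ} {σ : Equiv.Perm (Fin K)}
    (hσ : Antitone fun i => μ (σ i)) (hμ : ∀ k, 0 ≤ μ k) {D : Finset (Fin K)} {m : ℕ}
    (hm : m ≤ K) (hD : D.card ≤ m) : ∑ k ∈ D, μ k ≤ ∑ i : Fin m, μ (σ (Fin.castLE hm i)) := by
  have htop : ∑ i : Fin m, μ (σ (Fin.castLE hm i)) =
      ∑ k ∈ (Finset.univ.map (Fin.castLEEmb hm)).map σ.toEmbedding, μ k := by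
    simp
  rw [htop]
  rcases Nat.eq_zero_or_pos m with rfl | hpos
  · rw [Finset.card_eq_zero.1 (Nat.le_zero.1 hD)]
    simp
  set R := (Finset.univ.map (Fin.castLEEmb hm)).map σ.toEmbedding with hR
  have hcard : R.card = m := by simp [hR]
  have hmem : ∀ i, σ i ∈ R ↔ i.val < m := by
    intro i
    rw [hR, Finset.mem_map_equiv, Equiv.symm_apply_apply, Finset.mem_map]
    constructor
    · rintro ⟨a, _, rfl⟩
      exact a.isLt
    · exact fun h => ⟨⟨i, h⟩, Finset.mem_univ _, rfl⟩
  -- compare both sums after subtracting the `m`-th largest mean from each term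
  set θ := μ (σ ⟨m - 1, by omega⟩)
  have hin : ∀ k ∈ R, θ ≤ μ k := by
    intro k hk
    obtain ⟨i, rfl⟩ := σ.surjective k
    have := (hmem i).1 hk
    exact hσ (Fin.le_def.2 (by simp only; omega))
  have hout : ∀ k, k ∉ R → μ k ≤ θ := by
    intro k hk
    obtain ⟨i, rfl⟩ := σ.surjective k
    have := mt (hmem i).2 hk
    exact hσ (Fin.le_def.2 (by simp only; omega))
  have h1 : ∑ k ∈ D, (μ k - θ) ≤ ∑ k ∈ R, (μ k - θ) := by
    calc ∑ k ∈ D, (μ k - θ) ≤ ∑ k ∈ D ∩ R, (μ k - θ) := by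
          rw [← Finset.sum_inter_add_sum_sdiff D R]
          have : ∑ k ∈ D \ R, (μ k - θ) ≤ 0 := Finset.sum_nonpos fun k hk =>
            sub_nonpos.2 (hout k (Finset.mem_sdiff.1 hk).2)
          linarith
      _ ≤ _ := Finset.sum_le_sum_of_subset_of_nonneg Finset.inter_subset_right
          fun k hk _ => sub_nonneg.2 (hin k hk)
  rw [Finset.sum_sub_distrib, Finset.sum_sub_distrib, Finset.sum_const, Finset.sum_const, hcard,
    nsmul_eq_mul, nsmul_eq_mul] at h1
  have h2 : (D.card : ℝ) * θ ≤ m * θ :=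
    mul_le_mul_of_nonneg_right (by exact_mod_cast hD) (hμ _)
  linarith

variable {K N : ℕ}

/-- Defenders who do not collide are on distinct arms. -/
theorem sum_received_eq (μ : Fin K → ℝ) (d : Fin N → Fin K) (a : Option (Fin K)) :
    ∑ j, received (μ (d j)) (defCollides d a j) =
      ∑ k ∈ (Finset.univ.filter fun j => defCollides d a j = false).image d, μ k := by
  rw [Finset.sum_image, Finset.sum_filter]
  · exact Finset.sum_congr rfl fun j _ => by cases defCollides d a j <;> simp [received]
  · intro i hi j hj hij
    by_contra hne
    have h := of_decide_eq_false (Finset.mem_filter.1 (Finset.mem_coe.1 hi)).2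
    exact h (Or.inl ⟨j, Ne.symm hne, hij.symm⟩)

theorem sum_received_le {μ : Fin K → ℝ} {σ : Equiv.Perm (Fin K)}
    (hσ : Antitone fun i => μ (σ i)) (hμ : ∀ k, 0 ≤ μ k) (hN : N ≤ K) (d : Fin N → Fin K)
    (a : Option (Fin K)) :
    ∑ j, received (μ (d j)) (defCollides d a j) ≤ ∑ i : Fin N, μ (σ (Fin.castLE hN i)) := by
  rw [sum_received_eq]
  refine sum_le_sum_top hσ hμ hN (Finset.card_image_le.trans ?_)
  simpa using Finset.card_filter_le (Finset.univ : Finset (Fin N)) _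

/-- A defender on an arm that is not among the `N` best costs the defenders at least the gap. -/
theorem sum_received_le_sub {μ : Fin K → ℝ} {σ : Equiv.Perm (Fin K)}
    (hσ : Antitone fun i => μ (σ i)) (hμ : ∀ k, 0 ≤ μ k) (h1 : 1 ≤ N) (hNK : N < K)
    {d : Fin N → Fin K} {a : Option (Fin K)} {v : Fin N} {i : Fin K} (hi : N ≤ i.val)
    (hv : d v = σ i) :
    ∑ j, received (μ (d j)) (defCollides d a j) ≤
      ∑ i : Fin N, μ (σ (Fin.castLE hNK.le i)) -
        (μ (σ ⟨N - 1, (Nat.sub_le N 1).trans_lt hNK⟩) - μ (σ ⟨N, hNK⟩)) := by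
  obtain ⟨M, rfl⟩ : ∃ M, N = M + 1 := ⟨N - 1, by omega⟩
  rw [sum_received_eq, Fin.sum_univ_castSucc]
  set D := (Finset.univ.filter fun j => defCollides d a j = false).image d with hD
  have hle : μ (σ i) ≤ μ (σ ⟨M + 1, hNK⟩) := hσ (Fin.le_def.2 hi)
  have herase : ∑ k ∈ D.erase (σ i), μ k ≤
      ∑ i : Fin M, μ (σ (Fin.castLE ((Nat.le_succ M).trans hNK.le) i)) := by
    refine sum_le_sum_top hσ hμ _ ?_
    calc (D.erase (σ i)).card ≤ ((Finset.univ.erase v).image d).card := by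
          refine Finset.card_le_card fun k hk => ?_
          obtain ⟨hne, hk⟩ := Finset.mem_erase.1 hk
          obtain ⟨j, _, rfl⟩ := Finset.mem_image.1 hk
          refine Finset.mem_image_of_mem _ (Finset.mem_erase.2 ⟨?_, Finset.mem_univ _⟩)
          rintro rfl
          exact hne hv
      _ ≤ M := Finset.card_image_le.trans (by simp)
  have hsum : ∑ k ∈ D, μ k ≤ ∑ k ∈ D.erase (σ i), μ k + μ (σ i) := by
    by_cases h : σ i ∈ D
    · rw [Finset.sum_erase_add _ _ h]
    · rw [Finset.erase_eq_of_notMem h]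
      linarith [hμ (σ i)]
  have e : (Fin.castLE hNK.le (Fin.last M)) = (⟨M + 1 - 1, (Nat.sub_le (M + 1) 1).trans_lt hNK⟩) :=
    rfl
  rw [e]
  have e' : ∀ i : Fin M, Fin.castLE hNK.le i.castSucc =
      Fin.castLE ((Nat.le_succ M).trans hNK.le) i := fun i => rfl
  simp only [e']
  linarith

variable {T : ℕ} {p₀ : ℕ} {A : Attack K} {fallback : Fin N → ℕ → Fin K} {ω : Outcome K N T}

theorem regret_eq_sum (ν : Fin K → Measure ℝ) (σ : Equiv.Perm (Fin K)) (hN : N ≤ K) :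
    regret p₀ A fallback ν σ hN ω = ∑ t : Fin T,
      (∑ i : Fin N, armMean ν (σ (Fin.castLE hN i)) -
        ∑ j : Fin N, received (armMean ν (defArm p₀ A fallback ω t j))
          (defCollides (defArm p₀ A fallback ω t) (attArm p₀ A fallback ω t) j)) := by
  rw [Finset.sum_sub_distrib, Finset.sum_const, Finset.card_univ, Fintype.card_fin, nsmul_eq_mul]
  rfl

theorem regret_nonneg {ν : Fin K → Measure ℝ} {σ : Equiv.Perm (Fin K)}
    (hσ : Antitone fun i => armMean ν (σ i)) (hν : ∀ k, 0 ≤ armMean ν k) (hN : N ≤ K) :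
    0 ≤ regret p₀ A fallback ν σ hN ω := by
  rw [regret_eq_sum]
  exact Finset.sum_nonneg fun t _ => sub_nonneg.2 (sum_received_le hσ hν hN _ _)

/-- If a defender commits to a bad target before round `m`, each later round costs the gap. -/
theorem le_regret_of_commitsToTarget {ν : Fin K → Measure ℝ} {σ : Equiv.Perm (Fin K)}
    (hσ : Antitone fun i => armMean ν (σ i)) (hν : ∀ k, 0 ≤ armMean ν k) (h1 : 1 ≤ N)
    (hNK : N < K) {τ : ℝ} {m : ℕ} (hm : τ ≤ m) {i : Fin K} (hi : N ≤ i.val) (hω : ω.1.1 = σ i)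
    (h : CommitsToTarget p₀ A fallback τ ω) :
    (armMean ν (σ ⟨N - 1, (Nat.sub_le N 1).trans_lt hNK⟩) - armMean ν (σ ⟨N, hNK⟩)) *
      ((T : ℝ) - m) ≤ regret p₀ A fallback ν σ hNK.le ω := by
  obtain ⟨v, hv⟩ := h
  set Δ := armMean ν (σ ⟨N - 1, (Nat.sub_le N 1).trans_lt hNK⟩) - armMean ν (σ ⟨N, hNK⟩) with hΔ
  have hΔ0 : 0 ≤ Δ := sub_nonneg.2 (hσ (Fin.le_def.2 (Nat.sub_le N 1)))
  rw [regret_eq_sum]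
  have hcard : (T : ℝ) - m ≤ ((Finset.univ.filter fun t : Fin T => m ≤ t.val).card : ℝ) := by
    have h2 : (Finset.range T).card ≤ (Finset.range m ∪
        (Finset.univ.filter fun t : Fin T => m ≤ t.val).map Fin.valEmbedding).card := by
      refine Finset.card_le_card fun t ht => ?_
      rcases lt_or_ge t m with h | h
      · exact Finset.mem_union_left _ (Finset.mem_range.2 h)
      · refine Finset.mem_union_right _ (Finset.mem_map.2
          ⟨⟨t, Finset.mem_range.1 ht⟩, ?_, rfl⟩)
        simpa using h
    have h3 := h2.trans (Finset.card_union_le _ _)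
    rw [Finset.card_range, Finset.card_range, Finset.card_map] at h3
    have h4 : (T : ℝ) ≤ m + ((Finset.univ.filter fun t : Fin T => m ≤ t.val).card : ℝ) := by
      exact_mod_cast h3
    linarith
  calc Δ * ((T : ℝ) - m) ≤ Δ * ((Finset.univ.filter fun t : Fin T => m ≤ t.val).card : ℝ) :=
        mul_le_mul_of_nonneg_left hcard hΔ0
    _ = ∑ t ∈ Finset.univ.filter fun t : Fin T => m ≤ t.val, Δ := by
        rw [Finset.sum_const, nsmul_eq_mul, mul_comm]
    _ ≤ ∑ t ∈ Finset.univ.filter fun t : Fin T => m ≤ t.val, _ := by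
        refine Finset.sum_le_sum fun t ht => ?_
        have htm : (m : ℝ) ≤ (t.val : ℝ) := by exact_mod_cast (Finset.mem_filter.1 ht).2
        have := sum_received_le_sub hσ hν h1 hNK (a := attArm p₀ A fallback ω t) hi
          ((hv t (hm.trans htm)).trans hω)
        linarith
    _ ≤ _ := Finset.sum_le_sum_of_subset_of_nonneg (Finset.filter_subset _ _) fun t _ _ =>
        sub_nonneg.2 (sum_received_le hσ hν hNK.le _ _)

theorem armMean_nonneg {ν : Fin K → Measure ℝ} (hν : ∀ k, ν k (Set.Icc 0 1)ᶜ = 0) (k : Fin K) :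
    0 ≤ armMean ν k := by
  refine integral_nonneg_of_ae ?_
  have h : ∀ᵐ x ∂(ν k), x ∈ Set.Icc (0 : ℝ) 1 := hν k
  filter_upwards [h] with x hx using hx.1

end

section

/-! ### Probability of a successful Musical Chairs -/

variable {K N T : ℕ}

theorem measurable_draw :
    Measurable fun w : Round K N => fun j => (w.2 j).1 :=
  measurable_pi_iff.2 fun j => ((measurable_pi_apply j).comp measurable_snd).fst

theorem measurableSet_draw (D : Set (Fin N → Fin K)) :
    MeasurableSet {w : Round K N | (fun j => (w.2 j).1) ∈ D} :=
  measurable_draw MeasurableSet.of_discrete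

variable [NeZero K] {ν : Fin K → Measure ℝ} [∀ k, IsProbabilityMeasure (ν k)]
  {ρ : Measure ℝ} [IsProbabilityMeasure ρ]

instance isProbabilityMeasure_roundLaw : IsProbabilityMeasure (roundLaw N ν ρ) := by
  unfold roundLaw
  infer_instance

instance isProbabilityMeasure_gameLaw (A : Attack K) :
    IsProbabilityMeasure (gameLaw N T A ν ρ) := by
  unfold gameLaw
  infer_instance

theorem roundLaw_real_draw_mem (B : Fin N → Finset (Fin K)) :
    (roundLaw N ν ρ).real {w | ∀ j, (w.2 j).1 ∈ B j} = ∏ j, ((B j).card : ℝ) / K := by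
  have hset : {w : Round K N | ∀ j, (w.2 j).1 ∈ B j} =
      Set.univ ×ˢ Set.univ.pi fun j => (B j : Set (Fin K)) ×ˢ Set.univ := by
    ext w
    simp
  rw [measureReal_def, hset, roundLaw, Measure.prod_prod, Measure.pi_pi, measure_univ, one_mul,
    ENNReal.toReal_prod]
  refine Finset.prod_congr rfl fun j _ => ?_
  rw [Measure.prod_prod, measure_univ, mul_one,
    PMF.toMeasure_uniformOfFintype_apply _ MeasurableSet.of_discrete]
  simp

theorem roundLaw_real_draw_eq (d : Fin N → Fin K) :
    (roundLaw N ν ρ).real {w | (fun j => (w.2 j).1) = d} = (1 / K : ℝ) ^ N := by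
  have h := roundLaw_real_draw_mem (ν := ν) (ρ := ρ) fun j => {d j}
  simpa [funext_iff] using h

theorem third_le_pow (hN : 1 ≤ N) (hNK : N < K) :
    (1 / 3 : ℝ) ≤ (((K - 1 : ℕ) : ℝ) / K) ^ (N - 1) := by
  obtain ⟨m, rfl⟩ : ∃ m, K = m + 1 := ⟨K - 1, by omega⟩
  have hm : 0 < m := by omega
  have hm' : (0 : ℝ) < m := by exact_mod_cast hm
  have hinv : (((m + 1 - 1 : ℕ) : ℝ) / ((m + 1 : ℕ) : ℝ)) = (1 / m + 1 : ℝ)⁻¹ := by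
    rw [Nat.add_sub_cancel]
    push_cast
    field_simp
    ring
  rw [hinv, inv_pow, one_div]
  refine inv_anti₀ (by positivity) ?_
  calc (1 / m + 1 : ℝ) ^ (N - 1) ≤ (1 / m + 1 : ℝ) ^ m :=
        pow_le_pow_right₀ (by have : (0 : ℝ) ≤ 1 / m := by positivity
                              linarith) (by omega)
    _ ≤ Real.exp (1 / m) ^ m := pow_le_pow_left₀ (by positivity) (Real.add_one_le_exp _) _
    _ = Real.exp 1 := by rw [← Real.exp_nat_mul]; congr 1; field_simp
    _ ≤ 3 := by have := Real.exp_one_lt_d9; linarith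

/-- With probability at least `1 / 6`, defender `j` draws a good arm which nobody else draws. -/
theorem sixth_le_roundLaw_real (hNK : N < K) (g : Fin K) (j : Fin N) :
    (1 / 6 : ℝ) ≤ (roundLaw N ν ρ).real
      {w | (w.2 j).1 ∈ goodArms g ∧ ∀ i, i ≠ j → (w.2 i).1 ≠ (w.2 j).1} := by
  have hN : 1 ≤ N := by have := j.isLt; omega
  have hK : (0 : ℝ) < K := by exact_mod_cast NeZero.pos K
  have hset : {w : Round K N | (w.2 j).1 ∈ goodArms g ∧ ∀ i, i ≠ j → (w.2 i).1 ≠ (w.2 j).1} =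
      ⋃ a ∈ goodArms g, {w : Round K N | ∀ i, (w.2 i).1 ∈
        (if i = j then {a} else {a}ᶜ : Finset (Fin K))} := by
    ext w
    simp only [Set.mem_ofPred_eq, Set.mem_iUnion, exists_prop]
    constructor
    · rintro ⟨h, h'⟩
      refine ⟨_, h, fun i => ?_⟩
      by_cases hi : i = j
      · simp [hi]
      · simpa [hi] using h' i hi
    · rintro ⟨a, ha, h⟩
      have hj : (w.2 j).1 = a := by simpa using h j
      refine ⟨hj ▸ ha, fun i hi => ?_⟩
      simpa [hi, hj] using h i
  have hterm : ∀ a : Fin K, (roundLaw N ν ρ).real {w : Round K N | ∀ i, (w.2 i).1 ∈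
      (if i = j then {a} else {a}ᶜ : Finset (Fin K))} =
        1 / K * (((K - 1 : ℕ) : ℝ) / K) ^ (N - 1) := by
    intro a
    rw [roundLaw_real_draw_mem, ← Finset.mul_prod_erase _ _ (Finset.mem_univ j)]
    congr 1
    · simp
    · rw [Finset.prod_congr rfl (g := fun _ => ((K - 1 : ℕ) : ℝ) / K), Finset.prod_const,
        Finset.card_erase_of_mem (Finset.mem_univ j), Finset.card_univ, Fintype.card_fin]
      intro i hi
      rw [if_neg (Finset.ne_of_mem_erase hi), Finset.card_compl, Finset.card_singleton,
        Fintype.card_fin]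
  rw [hset, measureReal_biUnion_finset]
  · simp only [hterm, Finset.sum_const, nsmul_eq_mul]
    have h1 : (1 / 2 : ℝ) ≤ (goodArms g).card * (1 / K) := by
      rw [mul_one_div, div_le_div_iff₀ two_pos hK]
      have : (K : ℝ) ≤ 2 * (goodArms g).card := by exact_mod_cast le_two_mul_card_goodArms g
      linarith
    have h2 := third_le_pow hN hNK
    calc (1 / 6 : ℝ) = 1 / 2 * (1 / 3) := by norm_num
      _ ≤ (goodArms g).card * (1 / K) * (((K - 1 : ℕ) : ℝ) / K) ^ (N - 1) :=
          mul_le_mul h1 h2 (by norm_num) (by positivity)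
      _ = _ := by ring
  · intro a _ b _ hab
    refine Set.disjoint_left.2 fun w ha hb => hab ?_
    have h1 := ha j
    have h2 := hb j
    simp only [if_true, Finset.mem_singleton] at h1 h2
    exact h1.symm.trans h2
  · intro a _
    exact measurableSet_draw {d | ∀ i, d i ∈ (if i = j then {a} else {a}ᶜ : Finset (Fin K))}

theorem pi_real_forall_lt {Ω : Type*} [MeasurableSpace Ω] (μ : Measure Ω) [IsProbabilityMeasure μ]
    (G : Set Ω) {n : ℕ} (hn : n ≤ T) :
    (Measure.pi fun _ : Fin T => μ).real {w | ∀ t : Fin T, t.val < n → w t ∈ G} =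
      μ.real G ^ n := by
  have hset : {w : Fin T → Ω | ∀ t : Fin T, t.val < n → w t ∈ G} =
      Set.univ.pi fun t : Fin T => if t.val < n then G else Set.univ := by
    ext w
    simp only [Set.mem_ofPred_eq, Set.mem_pi, Set.mem_univ, true_imp_iff]
    refine forall_congr' fun t => ?_
    by_cases h : t.val < n <;> simp [h]
  rw [measureReal_def, hset, Measure.pi_pi, ENNReal.toReal_prod]
  have : ∀ t : Fin T, (μ (if t.val < n then G else Set.univ)).toReal =
      if t.val < n then μ.real G else 1 := fun t => by
    split_ifs
    · rfl
    · simp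
  simp only [this]
  rw [Finset.prod_ite, Finset.prod_const, Finset.prod_const_one, mul_one]
  congr 1
  rw [Fin.card_filter_val_lt, min_eq_right hn]

/-- The event that defender `j` settles on a good arm in the first round, and all the shifted draws
occur in the first `n` rounds. -/
def chairsEvent (hN : N ≤ K) (j : Fin N) (g : Fin K) (n : ℕ) : Set (Fin T → Round K N) :=
  {w | draws w 0 j ∈ goodArms g ∧ (∀ i, i ≠ j → draws w 0 i ≠ draws w 0 j) ∧
    ∀ s, ∃ t < n, draws w t = shiftedDraw hN s}

theorem measurable_draws (t : ℕ) :
    Measurable fun w : Fin T → Round K N => draws w t := by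
  by_cases h : t < T
  · have : (fun w : Fin T → Round K N => draws w t) = fun w => fun j => ((w ⟨t, h⟩).2 j).1 := by
      funext w j
      exact draws_of_lt h j
    rw [this]
    exact measurable_draw.comp (measurable_pi_apply _)
  · have : (fun w : Fin T → Round K N => draws w t) = fun _ _ => 0 := by
      funext w j
      exact dif_neg h
    rw [this]
    exact measurable_const

theorem measurableSet_chairsEvent (hN : N ≤ K) (j : Fin N) (g : Fin K) (n : ℕ) :
    MeasurableSet (chairsEvent (T := T) hN j g n) := by
  have : chairsEvent (T := T) hN j g n = {w | draws w 0 ∈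
      {d : Fin N → Fin K | d j ∈ goodArms g ∧ ∀ i, i ≠ j → d i ≠ d j}} ∩
      ⋂ s, ⋃ t ∈ Set.Iio n, {w | draws w t ∈ ({shiftedDraw hN s} : Set (Fin N → Fin K))} := by
    ext w
    simp [chairsEvent, and_assoc]
  rw [this]
  refine MeasurableSet.inter (measurable_draws 0 MeasurableSet.of_discrete) ?_
  refine MeasurableSet.iInter fun s => MeasurableSet.biUnion (Set.to_countable _) fun t _ => ?_
  exact measurable_draws t MeasurableSet.of_discrete

theorem le_pi_real_chairsEvent (hN : N ≤ K) (hNK : N < K) (j : Fin N) (g : Fin K) {n : ℕ}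
    (hn : n ≤ T) (hT : 0 < T) :
    1 / 6 - K * (1 - (1 / K : ℝ) ^ K) ^ n ≤
      (Measure.pi fun _ : Fin T => roundLaw N ν ρ).real (chairsEvent hN j g n) := by
  have hK : (1 : ℝ) ≤ K := by exact_mod_cast NeZero.pos K
  set P := Measure.pi fun _ : Fin T => roundLaw N ν ρ with hP
  set E₀ : Set (Fin T → Round K N) :=
    {w | draws w 0 j ∈ goodArms g ∧ ∀ i, i ≠ j → draws w 0 i ≠ draws w 0 j}
  set F : Fin K → Set (Fin T → Round K N) := fun s =>
    {w | ∀ t : Fin T, t.val < n → w t ∈ {r : Round K N | (fun i => (r.2 i).1) = shiftedDraw hN s}ᶜ}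
  have hE₀ : 1 / 6 ≤ P.real E₀ := by
    refine (sixth_le_roundLaw_real (ν := ν) (ρ := ρ) hNK g j).trans_eq ?_
    have h := pi_real_forall_lt (T := T) (roundLaw N ν ρ)
      {w | (w.2 j).1 ∈ goodArms g ∧ ∀ i, i ≠ j → (w.2 i).1 ≠ (w.2 j).1} (n := 1) hT
    rw [pow_one] at h
    rw [← h]
    congr 1
    ext w
    simp only [E₀, draws_of_lt hT, Set.mem_ofPred_eq]
    constructor
    · exact fun h => h ⟨0, hT⟩ zero_lt_one
    · intro h t ht
      have : t = ⟨0, hT⟩ := Fin.ext (by simpa using ht)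
      exact this ▸ h
  have hF : ∀ s, P.real (F s) ≤ (1 - (1 / K : ℝ) ^ K) ^ n := by
    intro s
    have hmeas : MeasurableSet {r : Round K N | (fun i => (r.2 i).1) = shiftedDraw hN s} :=
      measurableSet_draw {shiftedDraw hN s}
    rw [pi_real_forall_lt _ _ hn, probReal_compl_eq_one_sub hmeas, roundLaw_real_draw_eq]
    have h1 : (1 / K : ℝ) ≤ 1 := by rw [div_le_one (by positivity)]; exact hK
    refine pow_le_pow_left₀ (sub_nonneg.2 (pow_le_one₀ (by positivity) h1)) ?_ n
    exact sub_le_sub_left (pow_le_pow_of_le_one (by positivity) h1 hN) 1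
  have hsub : E₀ ⊆ chairsEvent hN j g n ∪ ⋃ s, F s := by
    intro w hw
    by_cases h : ∀ s, ∃ t < n, draws w t = shiftedDraw hN s
    · exact Or.inl ⟨hw.1, hw.2, h⟩
    · right
      push Not at h
      obtain ⟨s, hs⟩ := h
      refine Set.mem_iUnion.2 ⟨s, fun t ht he => hs t ht ?_⟩
      funext i
      rw [draws_of_lt t.isLt]
      exact congrFun he i
  have hsum : P.real (⋃ s, F s) ≤ K * (1 - (1 / K : ℝ) ^ K) ^ n := by
    calc P.real (⋃ s, F s) ≤ ∑ s, P.real (F s) := measureReal_iUnion_fintype_le _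
      _ ≤ ∑ _s : Fin K, (1 - (1 / K : ℝ) ^ K) ^ n := Finset.sum_le_sum fun s _ => hF s
      _ = _ := by simp
  have h := (measureReal_mono (μ := P) hsub).trans (measureReal_union_le _ _)
  linarith

/-- The target is `g`, and Musical Chairs goes as the attack requires. -/
def successEvent (hN : N ≤ K) (j : Fin N) (g : Fin K) (n : ℕ) : Set (Outcome K N T) :=
  {ω | ω.1.1 = g ∧ ω.2 ∈ chairsEvent hN j g n}

theorem measurableSet_successEvent (hN : N ≤ K) (j : Fin N) (g : Fin K) (n : ℕ) :
    MeasurableSet (successEvent (T := T) hN j g n) :=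
  (measurable_fst.fst (MeasurableSet.singleton g)).inter
    (measurable_snd (measurableSet_chairsEvent hN j g n))

theorem gameLaw_real_successEvent (hN : N ≤ K) (j : Fin N) (g : Fin K) (n : ℕ) :
    (gameLaw N T (attack K T) ν ρ).real (successEvent hN j g n) =
      1 / K * (Measure.pi fun _ : Fin T => roundLaw N ν ρ).real (chairsEvent hN j g n) := by
  have hset : successEvent (T := T) hN j g n =
      (Prod.fst ⁻¹' {g}) ×ˢ chairsEvent hN j g n := by
    ext ω
    rfl
  rw [measureReal_def, hset, gameLaw, Measure.prod_prod, ENNReal.toReal_mul,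
    ← Measure.map_apply measurable_fst (MeasurableSet.singleton g),
    PMF.toMeasure_map _ _ measurable_fst,
    PMF.toMeasure_apply_singleton _ _ (MeasurableSet.singleton g), map_fst_law_attack]
  simp [measureReal_def]

end

section

/-! ### The horizon and the bounds -/

/-- For long horizons, the commitment comes before round `5 K² log T ≤ T / 2 - 1`, and Musical
Chairs lasts long enough. -/
theorem exists_horizon (K : ℕ) [NeZero K] : ∃ T₀ : ℕ, ∀ T : ℕ, T₀ ≤ T →
    2 ≤ T ∧ K < chairsLength K T ∧
      (chairsLength K T : ℝ) + 2 * K + (K * 2 + K * K * K * 2) ≤ 5 * (K : ℝ) ^ 2 * Real.log T ∧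
      5 * (K : ℝ) ^ 2 * Real.log T + 1 ≤ T / 2 ∧
      K * (1 - (1 / K : ℝ) ^ K) ^ (chairsLength K T - K) ≤ 1 / 12 := by
  have hK : (1 : ℝ) ≤ K := by exact_mod_cast NeZero.pos K
  have hlog : Filter.Tendsto (fun T : ℕ => Real.log T) Filter.atTop Filter.atTop :=
    Real.tendsto_log_atTop.comp tendsto_natCast_atTop_atTop
  have hL : Filter.Tendsto (fun T : ℕ => chairsLength K T - K) Filter.atTop Filter.atTop :=
    (Filter.tendsto_sub_atTop_nat K).comp
      (tendsto_nat_ceil_atTop.comp (hlog.const_mul_atTop (zero_lt_one.trans_le hK)))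
  have hpow : Filter.Tendsto (fun T : ℕ => K * (1 - (1 / K : ℝ) ^ K) ^ (chairsLength K T - K))
      Filter.atTop (nhds 0) := by
    have h1 : (1 / K : ℝ) ≤ 1 := by rw [div_le_one (by positivity)]; exact hK
    have h2 : (0 : ℝ) < (1 / K : ℝ) ^ K := by positivity
    have h3 := (tendsto_pow_atTop_nhds_zero_of_lt_one
      (sub_nonneg.2 (pow_le_one₀ (by positivity) h1)) (sub_lt_self 1 h2)).comp hL
    simpa using h3.const_mul (K : ℝ)
  have hlin : ∀ᶠ T : ℕ in Filter.atTop, 5 * (K : ℝ) ^ 2 * Real.log T + 1 ≤ T / 2 := by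
    have h := (Real.isLittleO_log_id_atTop.comp_tendsto
      (tendsto_natCast_atTop_atTop (R := ℝ))).bound
        (show (0 : ℝ) < 1 / (20 * (K : ℝ) ^ 2) by positivity)
    filter_upwards [h, Filter.eventually_ge_atTop 4] with T hT hT4
    have hT4' : (4 : ℝ) ≤ T := by exact_mod_cast hT4
    simp only [Function.comp_apply, id, Real.norm_eq_abs, Nat.abs_cast] at hT
    have h5 := mul_le_mul_of_nonneg_left ((le_abs_self _).trans hT)
      (show (0 : ℝ) ≤ 5 * (K : ℝ) ^ 2 by positivity)
    have h6 : 5 * (K : ℝ) ^ 2 * (1 / (20 * (K : ℝ) ^ 2) * T) = T / 4 := by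
      field_simp
      ring
    linarith
  obtain ⟨T₀, h⟩ := Filter.eventually_atTop.1
    ((Filter.eventually_ge_atTop 2).and ((hL.eventually_ge_atTop 1).and
      ((hlog.eventually_ge_atTop (2 * K + 5 : ℝ)).and
        (hlin.and (hpow.eventually_le_const (show (0 : ℝ) < 1 / 12 by norm_num))))))
  refine ⟨T₀, fun T hT => ?_⟩
  obtain ⟨h2, h1, hlogT, hlinT, hpowT⟩ := h T hT
  refine ⟨h2, by omega, ?_, hlinT, hpowT⟩
  have hlog0 : 0 ≤ Real.log T := by linarith
  have hceil : (chairsLength K T : ℝ) ≤ K * Real.log T + 1 :=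
    (Nat.ceil_lt_add_one (by positivity)).le
  have hKK : (K : ℝ) ≤ (K : ℝ) ^ 2 := by nlinarith
  have e1 : (K : ℝ) * Real.log T ≤ (K : ℝ) ^ 2 * Real.log T :=
    mul_le_mul_of_nonneg_right hKK hlog0
  have e2 : (K : ℝ) ^ 2 * (2 * K + 5) ≤ (K : ℝ) ^ 2 * Real.log T :=
    mul_le_mul_of_nonneg_left hlogT (by positivity)
  have e3 : (K : ℝ) ^ 2 * (2 * K + 5) = K * K * K * 2 + 5 * (K : ℝ) ^ 2 := by ring
  have e4 : (0 : ℝ) ≤ (K : ℝ) ^ 2 * Real.log T := by positivity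
  linarith

variable {K N T : ℕ} {p₀ : ℕ} {fallback : Fin N → ℕ → Fin K} {ω : Outcome K N T}

/-- The expected regret, if each target makes a defender commit with probability at least `q` before
round `m`: the `K - N` bad targets contribute `q` times the gap times `T - m` each. -/
theorem le_integral_regret {A : Attack K} {ν : Fin K → Measure ℝ} {μ : Measure (Outcome K N T)}
    [IsProbabilityMeasure μ] {σ : Equiv.Perm (Fin K)} (hσ : Antitone fun i => armMean ν (σ i))
    (hν : ∀ k, 0 ≤ armMean ν k) (h1 : 1 ≤ N) (hNK : N < K) {τ q : ℝ} {m : ℕ} (hm : τ ≤ m)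
    (hmT : m ≤ T) {E : Fin K → Set (Outcome K N T)} (hE : ∀ g, MeasurableSet (E g))
    (htarget : ∀ g, ∀ ω ∈ E g, ω.1.1 = g ∧ CommitsToTarget p₀ A fallback τ ω)
    (hq : ∀ g, q ≤ μ.real (E g)) :
    (K - N : ℝ) * q * ((armMean ν (σ ⟨N - 1, (Nat.sub_le N 1).trans_lt hNK⟩) -
      armMean ν (σ ⟨N, hNK⟩)) * (T - m)) ≤ ∫ ω, regret p₀ A fallback ν σ hNK.le ω ∂μ := by
  set c := (armMean ν (σ ⟨N - 1, (Nat.sub_le N 1).trans_lt hNK⟩) - armMean ν (σ ⟨N, hNK⟩)) *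
    ((T : ℝ) - m) with hc
  have hc0 : 0 ≤ c := mul_nonneg (sub_nonneg.2 (hσ (Fin.le_def.2 (Nat.sub_le N 1))))
    (sub_nonneg.2 (by exact_mod_cast hmT))
  set B : Finset (Fin K) := Finset.Ici ⟨N, hNK⟩ with hB
  have hcard : (B.card : ℝ) = K - N := by
    have : B.card = K - N := by rw [hB, Fin.card_Ici]
    rw [this, Nat.cast_sub hNK.le]
  set U := ⋃ i ∈ B, E (σ i) with hU
  have hUm : MeasurableSet U := Finset.measurableSet_biUnion _ fun i _ => hE _
  have hμU : (K - N : ℝ) * q ≤ μ.real U := by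
    rw [hU, measureReal_biUnion_finset _ fun i _ => hE _, ← hcard, ← nsmul_eq_mul]
    · exact Finset.card_nsmul_le_sum _ _ _ fun i _ => hq _
    · intro i _ i' _ hne
      refine Set.disjoint_left.2 fun ω h h' => hne (σ.injective ?_)
      exact (htarget _ ω h).1.symm.trans (htarget _ ω h').1
  calc (K - N : ℝ) * q * c ≤ μ.real U * c := mul_le_mul_of_nonneg_right hμU hc0
    _ = ∫ ω, U.indicator (fun _ => c) ω ∂μ := by
        rw [integral_indicator_const c hUm, smul_eq_mul]
    _ ≤ _ := by
        refine integral_mono ((integrable_const c).indicator hUm)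
          (integrable_regret μ ν σ hNK.le) fun ω => ?_
        by_cases hω : ω ∈ U
        · rw [Set.indicator_of_mem hω]
          obtain ⟨i, hi, hωi⟩ := Set.mem_iUnion₂.1 hω
          obtain ⟨ht, hcom⟩ := htarget _ ω hωi
          exact le_regret_of_commitsToTarget hσ hν h1 hNK hm
            (Fin.le_def.1 (Finset.mem_Ici.1 hi)) ht hcom
        · rw [Set.indicator_of_notMem hω]
          exact regret_nonneg hσ hν hNK.le

variable [NeZero K]

theorem commitsToTarget_of_mem_successEvent (hp₀ : p₀ ≤ 1) (hN : N ≤ K) (hNK : N < K)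
    (hT : 2 ≤ T) (hL : K < chairsLength K T)
    (hτ : (chairsLength K T : ℝ) + 2 * K + (K * 2 + K * K * K * 2) ≤
      5 * (K : ℝ) ^ 2 * Real.log T) {j : Fin N} {g : Fin K}
    (h : ω ∈ successEvent hN j g (chairsLength K T - K)) :
    CommitsToTarget p₀ (attack K T) fallback (5 * (K : ℝ) ^ 2 * Real.log T) ω := by
  obtain ⟨rfl, hgood, hfirst, hall⟩ := h
  obtain ⟨v, hv⟩ := exists_defArm_eq_target (p₀ := p₀) (fallback := fallback) hN hNK hT hL
    hgood hfirst hall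
  refine ⟨v, fun t ht => hv t ?_⟩
  have h1 : chairsLength K T + 2 * K + (K * 2 + K * K * K * 2) ≤ t.val := by
    exact_mod_cast hτ.trans ht
  have h2 : 2 ^ p₀ ≤ 2 := (Nat.pow_le_pow_right two_pos hp₀).trans_eq (pow_one 2)
  have h3 := Nat.mul_le_mul_left K h2
  have h4 := Nat.mul_le_mul_left (K * K * K) (show p₀ + 1 ≤ 2 by omega)
  omega

theorem twelfth_div_le_gameLaw_real {ν : Fin K → Measure ℝ} [∀ k, IsProbabilityMeasure (ν k)]
    {ρ : Measure ℝ} [IsProbabilityMeasure ρ] (hN : N ≤ K) (hNK : N < K)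
    (hn : chairsLength K T - K ≤ T) (hT : 0 < T)
    (hfail : K * (1 - (1 / K : ℝ) ^ K) ^ (chairsLength K T - K) ≤ 1 / 12) (j : Fin N)
    (g : Fin K) :
    1 / 12 / (K : ℝ) ≤ (gameLaw N T (attack K T) ν ρ).real
      (successEvent hN j g (chairsLength K T - K)) := by
  rw [gameLaw_real_successEvent, div_eq_mul_one_div, mul_comm]
  refine mul_le_mul_of_nonneg_left ?_ (by positivity)
  have := le_pi_real_chairsEvent (ν := ν) (ρ := ρ) hN hNK j g hn hT
  linarith

theorem integral_attackCost_le (μ : Measure (Outcome K N T)) [IsProbabilityMeasure μ] :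
    ∫ ω, attackCost p₀ (attack K T) fallback ω ∂μ ≤ 5 * (K : ℝ) ^ 2 * Real.log T := by
  rcases lt_or_ge T 2 with hT | hT
  -- for `T < 2` the bound is `0`, also for `T = 0`, where `log 0 = 0` in Lean
  · have h0 : Real.log T = 0 := by interval_cases T <;> simp
    simp [attackCost_eq_zero hT, h0]
  · have hK : (1 : ℝ) ≤ K := by exact_mod_cast NeZero.pos K
    have hlog : (0.69 : ℝ) ≤ Real.log T := by
      have h1 := Real.log_le_log two_pos (show (2 : ℝ) ≤ T by exact_mod_cast hT)
      have h2 := Real.log_two_gt_d9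
      linarith
    calc ∫ ω, attackCost p₀ (attack K T) fallback ω ∂μ ≤ ∫ _, (3 * K : ℝ) ∂μ :=
          integral_mono (integrable_attackCost μ) (integrable_const _) fun ω => attackCost_le
      _ = 3 * K := by simp
      _ ≤ 5 * ((K : ℝ) * 1) * 0.69 := by linarith
      _ ≤ 5 * (K : ℝ) ^ 2 * Real.log T := by
          rw [pow_two]
          gcongr

end

end SicMmab

end

theorem mainTheorem5 :
    ∃ C c : ℝ, 0 < C ∧ 0 < c ∧ ∀ (K : ℕ) [NeZero K], ∃ T₀ : ℕ,
      ∀ p₀ : ℕ, p₀ ≤ 1 → ∀ T : ℕ, ∃ A : SicMmab.Attack K,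
        (∀ k : Fin K, A.law.map Prod.fst k = (K : ENNReal)⁻¹) ∧
        ∀ (N : ℕ) (_ : 1 ≤ N) (hN : N ≤ K)
          (ν : Fin K → MeasureTheory.Measure ℝ)
          [∀ k, MeasureTheory.IsProbabilityMeasure (ν k)]
          (_ : ∀ k, ν k (Set.Icc 0 1)ᶜ = 0)
          (σ : Equiv.Perm (Fin K)) (_ : StrictAnti fun i => SicMmab.armMean ν (σ i))
          (ρ : MeasureTheory.Measure ℝ) [MeasureTheory.IsProbabilityMeasure ρ]
          (_ : ρ (Set.Ico 0 1)ᶜ = 0)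
          (fallback : Fin N → ℕ → Fin K),
          (MeasureTheory.Integrable (SicMmab.attackCost p₀ A fallback)
              (SicMmab.gameLaw N T A ν ρ) ∧
            ∫ ω, SicMmab.attackCost p₀ A fallback ω ∂(SicMmab.gameLaw N T A ν ρ)
              ≤ C * (K : ℝ) ^ 2 * Real.log T) ∧
          (T₀ ≤ T → ∀ hNK : N < K,
            (∀ k : Fin K,
              ENNReal.ofReal (c / K) ≤
                SicMmab.gameLaw N T A ν ρ
                  {ω | ω.1.1 = k ∧
                    SicMmab.CommitsToTarget p₀ A fallback (C * (K : ℝ) ^ 2 * Real.log T) ω}) ∧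
            MeasureTheory.Integrable (SicMmab.regret p₀ A fallback ν σ hN)
              (SicMmab.gameLaw N T A ν ρ) ∧
            c * (SicMmab.armMean ν (σ ⟨N - 1, (Nat.sub_le N 1).trans_lt hNK⟩) -
                  SicMmab.armMean ν (σ ⟨N, hNK⟩)) * (((K : ℝ) - N) / K) * T
              ≤ ∫ ω, SicMmab.regret p₀ A fallback ν σ hN ω ∂(SicMmab.gameLaw N T A ν ρ)) := by
  -- half of `1 / 12`, because the defender commits only by the middle of the game
  refine ⟨5, 1 / 24, by norm_num, by norm_num, fun K _ => ?_⟩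
  obtain ⟨T₀, hT₀⟩ := SicMmab.exists_horizon K
  refine ⟨T₀, fun p₀ hp₀ T => ⟨SicMmab.attack K T, SicMmab.map_fst_law_attack K T, ?_⟩⟩
  intro N hN1 hN ν _ hν σ hσ ρ _ _ fallback
  refine ⟨⟨SicMmab.integrable_attackCost _, SicMmab.integral_attackCost_le _⟩, fun hT hNK => ?_⟩
  obtain ⟨h2, hL, hτ, hhalf, hfail⟩ := hT₀ T hT
  have hK : (0 : ℝ) < K := by exact_mod_cast NeZero.pos K
  have hLT : SicMmab.chairsLength K T ≤ T := by
    have h0 : (0 : ℝ) ≤ T := Nat.cast_nonneg T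
    have h3 : (0 : ℝ) ≤ 2 * K + (K * 2 + K * K * K * 2) := by positivity
    have : (SicMmab.chairsLength K T : ℝ) ≤ T := by linarith
    exact_mod_cast this
  have hprob := fun g => SicMmab.twelfth_div_le_gameLaw_real (ν := ν) (ρ := ρ) hN hNK
    (by omega : SicMmab.chairsLength K T - K ≤ T) (by omega) hfail ⟨0, hN1⟩ g
  have hcom : ∀ g, ∀ ω ∈ SicMmab.successEvent (T := T) hN ⟨0, hN1⟩ g
      (SicMmab.chairsLength K T - K), ω.1.1 = g ∧ SicMmab.CommitsToTarget p₀
        (SicMmab.attack K T) fallback (5 * (K : ℝ) ^ 2 * Real.log T) ω := fun g ω hω =>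
    ⟨hω.1, SicMmab.commitsToTarget_of_mem_successEvent hp₀ hN hNK h2 hL hτ hω⟩
  refine ⟨fun k => ?_, SicMmab.integrable_regret _ ν σ hN, ?_⟩
  · calc ENNReal.ofReal (1 / 24 / K) ≤ ENNReal.ofReal
          ((SicMmab.gameLaw N T (SicMmab.attack K T) ν ρ).real (SicMmab.successEvent hN
            ⟨0, hN1⟩ k (SicMmab.chairsLength K T - K))) := by
          refine ENNReal.ofReal_le_ofReal (le_trans ?_ (hprob k))
          gcongr
          norm_num
      _ = SicMmab.gameLaw N T (SicMmab.attack K T) ν ρ (SicMmab.successEvent hN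
            ⟨0, hN1⟩ k (SicMmab.chairsLength K T - K)) := ENNReal.ofReal_toReal (measure_ne_top _ _)
      _ ≤ _ := measure_mono (hcom k)
  · set τ := 5 * (K : ℝ) ^ 2 * Real.log T
    have hτ0 : 0 ≤ τ := by positivity
    have hm : (⌈τ⌉₊ : ℝ) ≤ T / 2 := (Nat.ceil_lt_add_one hτ0).le.trans hhalf
    have hmT : ⌈τ⌉₊ ≤ T := by
      have h0 : (0 : ℝ) ≤ T := Nat.cast_nonneg T
      have : (⌈τ⌉₊ : ℝ) ≤ T := by linarith
      exact_mod_cast this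
    have hΔ : 0 ≤ SicMmab.armMean ν (σ ⟨N - 1, (Nat.sub_le N 1).trans_lt hNK⟩) -
        SicMmab.armMean ν (σ ⟨N, hNK⟩) :=
      sub_nonneg.2 (hσ.antitone (Fin.le_def.2 (Nat.sub_le N 1)))
    have hKN : (0 : ℝ) ≤ (K : ℝ) - N := sub_nonneg.2 (by exact_mod_cast hN)
    refine le_trans ?_ (SicMmab.le_integral_regret hσ.antitone (SicMmab.armMean_nonneg hν) hN1 hNK
      (Nat.le_ceil τ) hmT (fun g => SicMmab.measurableSet_successEvent hN ⟨0, hN1⟩ g _) hcom hprob)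
    have hhalf' : (T : ℝ) / 2 ≤ T - ⌈τ⌉₊ := by linarith
    calc _ = ((K : ℝ) - N) * (1 / 12 / K) *
          ((SicMmab.armMean ν (σ ⟨N - 1, (Nat.sub_le N 1).trans_lt hNK⟩) -
            SicMmab.armMean ν (σ ⟨N, hNK⟩)) * (T / 2)) := by ring
      _ ≤ _ := by gcongr
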